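/- **Theorem 6.5 (minimal realization, progressive case).** Let $\mathbb{T}^\star\subseteq\mathbb{R}$ be a time scale (a closed set of real numbers) with at least two points, with backward jump operator $\hat\rho$ (where $\hat\rho(\min\mathbb{T}^\star)=\min\mathbb{T}^\star$), backward graininess $\hat\nu(s)=s-\hat\rho(s)$ and nabla derivative $\hat\nabla$; let $(\mathbb{T}^\star)_\kappa$ be $\mathbb{T}^\star$ without its minimum if that minimum exists and is right-scattered, and $\mathbb{T}^\star$ otherwise. Consider the linear system $$\bar\Lambda:\qquad y^{\hat\nabla}(s)=\bar A(s)y(s)+\bar B(s)v(s),\qquad \gamma(s)=\bar C(s)y(s),$$ with state $y(s)\in\mathbb{R}^n$, control $v(s)\in\mathbb{R}^m$, output $\gamma(s)\in\mathbb{R}^p$ $(n,m,p\ge 0)$ and ld-continuous coefficient matrices. (A function is ld-continuous if it is continuous at the points with $\hat\rho(s)=s$ and has finite right limits at right-dense points.) Suppose that $\bar\Lambda$ is progressive, i.e. $I-\hat\nu(s)\bar A(s)$ is invertible for all $s\in(\mathbb{T}^\star)_\kappa$, so that the transition function $\Psi_{\bar A}(s,z)$ (the solution of $Y^{\hat\nabla}=\bar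 A Y$ with $Y(z)=I$) exists for all $s,z\in\mathbb{T}^\star$, both below and above $z$. A progressive system with $m$ inputs and $p$ outputs on $\mathbb{T}^\star$ *realizes* a function $\bar G$ if $\bar G(s,z)=\bar C(s)\Psi_{\bar A}(s,\hat\rho(z))\bar B(z)$ for all $s,z\in(\mathbb{T}^\star)_\kappa$; a realization of dimension $n$ is *minimal* if no such system of dimension $n'<n$ (with $n'=0$ allowed) realizes $\bar G$. For $s_1<s_0$ in $\mathbb{T}^\star$, the system is *controllable on* $[s_1,s_0]$ if for all $y_0,y_1\in\mathbb{R}^n$ some piecewise ld-continuous control on $[s_1,s_0]\cap\mathbb{T}^\star$ steers $y(s_0)=y_0$ to $y(s_1)=y_1$; it is *observable on* $[s_1,s_0]$ if, for a known control, $y(s_0)$ is uniquely determined by the output $\gamma(s)$, $s\in(s_1,s_0]\cap\mathbb{T}^\star$. Let $\bar\Lambda$ be a realization of $\bar G$. Then this realization is minimal if and only if there are $s_0,s_1\in\mathbb{T}^\star$ with $s_1<s_0$ such that $\bar\Lambda$ is both controllable and observable on $[s_1,s_0]$. -/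

import Mathlib

open Set Filter Topology

namespace NablaControl

noncomputable section

/-! ### Time scales: a time scale is a nonempty closed set `T` of real numbers -/

open Classical in
/-- Backward jump operator `ρ(s) = sup {t ∈ T | t < s}`, with `ρ(min T) = min T`. -/
def rho (T : Set ℝ) (s : ℝ) : ℝ :=
  if (T ∩ Iio s).Nonempty then sSup (T ∩ Iio s) else s

open Classical in
/-- Forward jump operator `σ(s) = inf {t ∈ T | s < t}`, with `σ(max T) = max T`. -/
def sigma (T : Set ℝ) (s : ℝ) : ℝ :=
  if (T ∩ Ioi s).Nonempty then sInf (T ∩ Ioi s) else s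

/-- Backward graininess `ν(s) = s - ρ(s)`. -/
def nu (T : Set ℝ) (s : ℝ) : ℝ := s - rho T s

/-- The set `T_κ`: the time scale without its minimum when that minimum exists and is
right-scattered, and the whole time scale otherwise. -/
def kappa (T : Set ℝ) : Set ℝ := {s | s ∈ T ∧ ¬ (IsLeast T s ∧ s < sigma T s)}

/-- `f` has nabla derivative `d` at `s` on the time scale `T`. -/
def HasNablaDeriv (T : Set ℝ) (f : ℝ → ℝ) (d s : ℝ) : Prop :=
  ∀ ε > 0, ∀ᶠ t in 𝓝[T] s, |f (rho T s) - f t - d * (rho T s - t)| ≤ ε * |rho T s - t|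

/-- `f` is ld-continuous on `T`: it is continuous at each left-dense point (`ρ(s) = s`) and has a
finite right-sided limit at each right-dense point (`σ(s) = s`). -/
def LdContinuous (T : Set ℝ) (f : ℝ → ℝ) : Prop :=
  ∀ s ∈ T, (rho T s = s → ContinuousWithinAt f T s) ∧
    (sigma T s = s → ∃ l : ℝ, Tendsto f (𝓝[T ∩ Ioi s] s) (𝓝 l))

/-- `f` is piecewise ld-continuous on `T`: the requirement of ld-continuity may fail at finitely
many points, and finite one-sided limits exist at all points (a one-sided limit is no condition
at a point that is scattered on that side). -/
def PiecewiseLdContinuous (T : Set ℝ) (f : ℝ → ℝ) : Prop :=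
  (∃ E : Set ℝ, E.Finite ∧ ∀ s ∈ T, s ∉ E → rho T s = s → ContinuousWithinAt f T s) ∧
  ∀ s ∈ T, (∃ l : ℝ, Tendsto f (𝓝[T ∩ Iio s] s) (𝓝 l)) ∧
    (∃ l : ℝ, Tendsto f (𝓝[T ∩ Ioi s] s) (𝓝 l))

/-! ### Linear backward control systems -/

/-- The system `y^∇(s) = A(s) y(s) + B(s) v(s)`, `γ(s) = C(s) y(s)` on the time scale `T`, with
ld-continuous coefficients, state dimension `n`, `m` inputs and `p` outputs. Only the values of
the coefficients at points of `T` are relevant. -/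
structure BackwardSystem (T : Set ℝ) (n m p : ℕ) where
  A : ℝ → Matrix (Fin n) (Fin n) ℝ
  B : ℝ → Matrix (Fin n) (Fin m) ℝ
  C : ℝ → Matrix (Fin p) (Fin n) ℝ
  ldA : ∀ i j, LdContinuous T (fun s => A s i j)
  ldB : ∀ i j, LdContinuous T (fun s => B s i j)
  ldC : ∀ i j, LdContinuous T (fun s => C s i j)

/-- `Ψ` is a transition function of `y^∇ = A y` on all of `T`: for each `z ∈ T`, the function
`s ↦ Ψ(s, z)` solves `Y^∇(s) = A(s) Y(s)` with `Y(z) = I`, both below and above `z`. -/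
def IsTransition (T : Set ℝ) {n : ℕ} (A : ℝ → Matrix (Fin n) (Fin n) ℝ)
    (Ψ : ℝ → ℝ → Matrix (Fin n) (Fin n) ℝ) : Prop :=
  ∀ z ∈ T, Ψ z z = 1 ∧
    ∀ s ∈ kappa T, ∀ i j, HasNablaDeriv T (fun t => Ψ t z i j) ((A s * Ψ s z) i j) s

open Classical in
/-- The transition function `Ψ_A`. On `T × T` it is determined by `IsTransition`; it is used only
for progressive systems, for which it exists. -/
def transition (T : Set ℝ) {n : ℕ} (A : ℝ → Matrix (Fin n) (Fin n) ℝ) :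
    ℝ → ℝ → Matrix (Fin n) (Fin n) ℝ :=
  if h : ∃ Ψ, IsTransition T A Ψ then h.choose else 0

namespace BackwardSystem

variable {T : Set ℝ} {n m p : ℕ}

/-- The system is progressive: `I - ν(s) A(s)` is invertible at each `s ∈ T_κ`. -/
def Progressive (S : BackwardSystem T n m p) : Prop :=
  ∀ s ∈ kappa T, IsUnit (1 - nu T s • S.A s)

/-- The weighting pattern `C(s) Ψ_A(s, ρ(z)) B(z)`. -/
def weightingPattern (S : BackwardSystem T n m p) (s z : ℝ) : Matrix (Fin p) (Fin m) ℝ :=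
  S.C s * transition T S.A s (rho T z) * S.B z

/-- The system realizes `G`: its weighting pattern is `G` for all `s, z ∈ T_κ`, in either order. -/
def Realizes (S : BackwardSystem T n m p) (G : ℝ → ℝ → Matrix (Fin p) (Fin m) ℝ) : Prop :=
  ∀ s ∈ kappa T, ∀ z ∈ kappa T, G s z = S.weightingPattern s z

/-- The system is a minimal realization of `G`: it realizes `G`, and no system of smaller
dimension does. (The two-sided transition function, hence the weighting pattern, exists only for
progressive systems, see `progressive_of_isTransition`.) -/
def IsMinimalRealization (S : BackwardSystem T n m p)
    (G : ℝ → ℝ → Matrix (Fin p) (Fin m) ℝ) : Prop :=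
  S.Realizes G ∧
    ∀ n' < n, ¬ ∃ S' : BackwardSystem T n' m p, S'.Progressive ∧ S'.Realizes G

/-- `y` is a solution on `[s₁, s₀] ∩ T` of `y^∇ = A y + B v` for a piecewise ld-continuous `v`:
`y` is continuous and the equation holds on `(s₁, s₀] ∩ T`, apart from finitely many left-dense
points (where `v` may jump). -/
def IsSolution (S : BackwardSystem T n m p) (s₁ s₀ : ℝ) (v : ℝ → Fin m → ℝ)
    (y : ℝ → Fin n → ℝ) : Prop :=
  ContinuousOn y (T ∩ Icc s₁ s₀) ∧
  ∃ E : Set ℝ, E.Finite ∧ ∀ s ∈ T ∩ Ioc s₁ s₀, (rho T s < s ∨ s ∉ E) →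
    ∀ i, HasNablaDeriv (T ∩ Icc s₁ s₀) (fun t => y t i)
      (((S.A s).mulVec (y s) + (S.B s).mulVec (v s)) i) s

/-- Controllability on `[s₁, s₀] ∩ T`: each state at time `s₀` can be steered to each state at
time `s₁` by a piecewise ld-continuous control. -/
def ControllableOn (S : BackwardSystem T n m p) (s₁ s₀ : ℝ) : Prop :=
  ∀ y₀ y₁ : Fin n → ℝ, ∃ (v : ℝ → Fin m → ℝ) (y : ℝ → Fin n → ℝ),
    (∀ k, PiecewiseLdContinuous (T ∩ Icc s₁ s₀) (fun s => v s k)) ∧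
    S.IsSolution s₁ s₀ v y ∧ y s₀ = y₀ ∧ y s₁ = y₁

/-- Observability on `[s₁, s₀] ∩ T`: for a known control, the initial state `y(s₀)` is uniquely
determined by the output `γ(s) = C(s) y(s)`, `s ∈ (s₁, s₀] ∩ T`. -/
def ObservableOn (S : BackwardSystem T n m p) (s₁ s₀ : ℝ) : Prop :=
  ∀ (v : ℝ → Fin m → ℝ) (y y' : ℝ → Fin n → ℝ),
    (∀ k, PiecewiseLdContinuous (T ∩ Icc s₁ s₀) (fun s => v s k)) →
    S.IsSolution s₁ s₀ v y → S.IsSolution s₁ s₀ v y' →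
    (∀ s ∈ T ∩ Ioc s₁ s₀, (S.C s).mulVec (y s) = (S.C s).mulVec (y' s)) → y s₀ = y' s₀

end BackwardSystem

/-- In a closed set, the backward jump of a point belongs to the set. -/
theorem rho_mem {T : Set ℝ} (hT : IsClosed T) {s : ℝ} (hs : s ∈ T) : rho T s ∈ T := by
  unfold rho
  split_ifs with h
  · have hb : BddAbove (T ∩ Iio s) := ⟨s, fun t ht => le_of_lt ht.2⟩
    exact closure_minimal inter_subset_left hT (csSup_mem_closure h hb)
  · exact hs

/-- A system that has a two-sided transition function is progressive. -/
theorem progressive_of_isTransition {T : Set ℝ} (hT : IsClosed T) {n m p : ℕ}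
    (S : BackwardSystem T n m p) {Ψ : ℝ → ℝ → Matrix (Fin n) (Fin n) ℝ}
    (h : IsTransition T S.A Ψ) : S.Progressive := by
  intro s hs
  obtain ⟨h1, h2⟩ := h (rho T s) (rho_mem hT hs.1)
  have key : (1 - nu T s • S.A s) * Ψ s (rho T s) = 1 := by
    ext i j
    have h3 : ∀ ε > 0, |Ψ (rho T s) (rho T s) i j - Ψ s (rho T s) i j
        - (S.A s * Ψ s (rho T s)) i j * (rho T s - s)| ≤ ε * |rho T s - s| :=
      fun ε hε => (h2 s hs i j ε hε).self_of_nhdsWithin hs.1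
    have h4 : Ψ (rho T s) (rho T s) i j - Ψ s (rho T s) i j
        - (S.A s * Ψ s (rho T s)) i j * (rho T s - s) = 0 := by
      by_contra hne
      have hpos := abs_pos.mpr hne
      rcases eq_or_lt_of_le (abs_nonneg (rho T s - s)) with h0 | h0
      · have := h3 1 one_pos
        rw [← h0] at this
        linarith
      · have := h3 (|Ψ (rho T s) (rho T s) i j - Ψ s (rho T s) i j
          - (S.A s * Ψ s (rho T s)) i j * (rho T s - s)| / (2 * |rho T s - s|)) (by positivity)
        have e : ∀ a b : ℝ, 0 < b → a / (2 * b) * b = a / 2 := by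
          intro a b hb
          field_simp
        rw [e _ _ h0] at this
        linarith
    rw [h1] at h4
    rw [sub_mul, one_mul, smul_mul_assoc, Matrix.sub_apply, Matrix.smul_apply, smul_eq_mul, nu]
    linarith
  exact IsUnit.of_mul_eq_one _ key

end

end NablaControl

/-!
The transition function of a progressive system factors as `Ψ(s, z) = Φ(s) X(z)` with a fundamental
matrix `Φ` and `X = Φ⁻¹`, so the weighting pattern is `L(s) R(z)` with the output factor
`L(s) = C(s) Φ(s)` and the input factor `R(z) = X(ρ(z)) B(z)`. In the coordinates `X y` the state
equation reads `(X y)^∇ = R v`, `γ = L (X y)`. Hence: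

* the system is controllable on `[s₁, s₀]` iff only `w = 0` satisfies `R(z)ᵀ w = 0` for all
  `z ∈ (s₁, s₀] ∩ T` (`ControllableOn.eq_zero_of_inputFactor`, and `controllableOn_of_inputFactor`
  by inverting the Gramian `∫ R Rᵀ`);
* it is observable on `[s₁, s₀]` iff only `x = 0` satisfies `L(s) x = 0` for all
  `s ∈ (s₁, s₀] ∩ T` (`ObservableOn.eq_zero_of_outputFactor`, `observableOn_of_outputFactor`).

If both conditions hold, every factorization of `L(s) R(z)` has inner dimension at least `n`
(`le_of_factorization`), so the realization is minimal. Conversely, a nonzero vector annihilated by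
all `R(z)ᵀ` or by all `L(s)` makes `L(s) R(z)` factor through dimension `n - 1`, and any such
factorization is realized by a system with `A = 0` (`exists_realization_of_factor`). In a minimal
realization there is thus no such vector, and by finite-dimensionality a bounded interval
suffices to see this (`exists_Ioc_injective`).

Everything rests on the existence of `Φ` (`exists_solution`, `exists_isFundamentalPair`) and on the
constancy of functions with vanishing nabla derivative (`eq_of_hasNablaDeriv_zero`). Functions on
`T` are extended to the line by rounding up to the next point of `T` (`ceilT`); the nabla integral
becomes a Lebesgue integral, and the equation `y^∇ = A y` a Volterra equation, which is solved by
its Peano–Baker series (`exists_volterra`).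
-/

namespace NablaControl

/-! ### Jump operators and the rounding map -/

variable {T : Set ℝ} {f g : ℝ → ℝ} {d e s t z s₀ s₁ : ℝ}

theorem rho_le : rho T s ≤ s := by
  unfold rho
  split_ifs with h
  · exact csSup_le h fun t ht => le_of_lt ht.2
  · exact le_rfl

theorem le_rho (ht : t ∈ T) (hts : t < s) : t ≤ rho T s := by
  have h : (T ∩ Iio s).Nonempty := ⟨t, ht, hts⟩
  rw [rho, if_pos h]
  exact le_csSup ⟨s, fun t ht => le_of_lt ht.2⟩ ⟨ht, hts⟩

theorem le_sigma : s ≤ sigma T s := by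
  unfold sigma
  split_ifs with h
  · exact le_csInf h fun t ht => le_of_lt ht.2
  · exact le_rfl

theorem sigma_le (ht : t ∈ T) (hst : s < t) : sigma T s ≤ t := by
  have h : (T ∩ Ioi s).Nonempty := ⟨t, ht, hst⟩
  rw [sigma, if_pos h]
  exact csInf_le ⟨s, fun u hu => le_of_lt hu.2⟩ ⟨ht, hst⟩

theorem rho_inter_Icc {a b : ℝ} (ha : a ∈ T) (has : a < s) (hsb : s ≤ b) :
    rho (T ∩ Icc a b) s = rho T s := by
  have h1 : (T ∩ Iio s).Nonempty := ⟨a, ha, has⟩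
  have h2 : ((T ∩ Icc a b) ∩ Iio s).Nonempty := ⟨a, ⟨ha, le_rfl, has.le.trans hsb⟩, has⟩
  apply le_antisymm
  · rw [rho, if_pos h2]
    exact csSup_le h2 fun t ht => le_rho ht.1.1 ht.2
  · rw [rho.eq_1 T, if_pos h1]
    refine csSup_le h1 fun t ht => ?_
    rcases le_or_gt a t with hat | hat
    · exact le_rho ⟨ht.1, hat, (le_of_lt ht.2).trans hsb⟩ ht.2
    · exact hat.le.trans (le_rho ⟨ha, le_rfl, has.le.trans hsb⟩ has)

theorem mem_kappa_of_lt (ht : t ∈ T) (hs : s ∈ T) (hts : t < s) : s ∈ kappa T :=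
  ⟨hs, fun h => absurd (h.1.2 ht) (not_le.2 hts)⟩

theorem kappa_subset : kappa T ⊆ T := fun _ h => h.1

/-- A point of `T` outside `kappa T` is isolated in `T`. -/
theorem nhdsWithin_eq_pure_of_notMem_kappa (hs : s ∈ T) (h : s ∉ kappa T) : 𝓝[T] s = pure s := by
  have h' : IsLeast T s ∧ s < sigma T s := by
    by_contra h'
    exact h ⟨hs, h'⟩
  obtain ⟨h1, h2⟩ := h'
  refine le_antisymm ?_ (pure_le_nhdsWithin hs)
  rw [le_pure_iff]
  filter_upwards [self_mem_nhdsWithin, mem_nhdsWithin_of_mem_nhds (Iio_mem_nhds h2)] with t ht ht'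
  rcases (h1.2 ht).eq_or_lt with rfl | hlt
  · rfl
  · exfalso
    exact absurd (sigma_le ht hlt) (not_le.2 ht')

/-- There are no points of `T` immediately to the right of a right-scattered point. -/
theorem nhdsWithin_Ioi_eq_bot (h : s < sigma T s) : 𝓝[T ∩ Ioi s] s = ⊥ := by
  rw [← empty_mem_iff_bot]
  filter_upwards [self_mem_nhdsWithin, mem_nhdsWithin_of_mem_nhds (Iio_mem_nhds h)] with t ht ht'
  exact absurd (sigma_le ht.1 ht.2) (not_le.2 ht')

/-- There are no points of `T` immediately to the left of a left-scattered point. -/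
theorem nhdsWithin_Iio_eq_bot (h : rho T s < s) : 𝓝[T ∩ Iio s] s = ⊥ := by
  rw [← empty_mem_iff_bot]
  filter_upwards [self_mem_nhdsWithin, mem_nhdsWithin_of_mem_nhds (Ioi_mem_nhds h)] with t ht ht'
  exact absurd (le_rho ht.1 ht.2) (not_le.2 ht')

open Classical in
/-- The map rounding a real number up to the next point of `T`; numbers beyond the maximum of `T`
are sent to the maximum. It is constant on each gap `(ρ(s), s]`, so that the nabla integral of `f`
over `(a, b] ∩ T` is the Lebesgue integral of `f ∘ ceilT T` over `(a, b]`. -/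
noncomputable def ceilT (T : Set ℝ) (t : ℝ) : ℝ :=
  if (T ∩ Ici t).Nonempty then sInf (T ∩ Ici t) else sSup T

theorem ceilT_mem (hT : IsClosed T) (hne : T.Nonempty) (t : ℝ) : ceilT T t ∈ T := by
  unfold ceilT
  split_ifs with h
  · exact closure_minimal inter_subset_left hT
      (csInf_mem_closure h ⟨t, fun u hu => hu.2⟩)
  · refine hT.csSup_mem hne ⟨t, fun u hu => ?_⟩
    by_contra hlt
    exact h ⟨u, hu, le_of_lt (not_le.1 hlt)⟩

theorem le_ceilT (hs : s ∈ T) (hts : t ≤ s) : t ≤ ceilT T t := by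
  have h : (T ∩ Ici t).Nonempty := ⟨s, hs, hts⟩
  rw [ceilT, if_pos h]
  exact le_csInf h fun u hu => hu.2

theorem ceilT_le (hs : s ∈ T) (hts : t ≤ s) : ceilT T t ≤ s := by
  have h : (T ∩ Ici t).Nonempty := ⟨s, hs, hts⟩
  rw [ceilT, if_pos h]
  exact csInf_le ⟨t, fun u hu => hu.2⟩ ⟨hs, hts⟩

theorem ceilT_self (hs : s ∈ T) : ceilT T s = s :=
  le_antisymm (ceilT_le hs le_rfl) (le_ceilT hs le_rfl)

theorem ceilT_mono (hT : IsClosed T) (hne : T.Nonempty) : Monotone (ceilT T) := by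
  intro t u htu
  by_cases h : (T ∩ Ici u).Nonempty
  · obtain ⟨s, hs, hus⟩ := h
    exact ceilT_le (ceilT_mem hT hne u) (htu.trans (le_ceilT hs hus))
  · rw [ceilT.eq_1 T u, if_neg h]
    refine le_csSup ⟨u, fun v hv => ?_⟩ (ceilT_mem hT hne t)
    by_contra hlt
    exact h ⟨v, hv, le_of_lt (not_le.1 hlt)⟩

theorem ceilT_eq (hT : IsClosed T) (hs : s ∈ T) (h1 : rho T s < t) (h2 : t ≤ s) :
    ceilT T t = s := by
  rcases (ceilT_le hs h2).eq_or_lt with h | h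
  · exact h
  · exact absurd ((le_ceilT hs h2).trans (le_rho (ceilT_mem hT ⟨s, hs⟩ t) h)) (not_le.2 h1)

/-- Rounding up is locally constant off `T`. -/
theorem eventually_ceilT_eq (hT : IsClosed T) (ht : t ∉ T) :
    ∀ᶠ u in 𝓝 t, ceilT T u = ceilT T t := by
  obtain ⟨ε, hε, hb⟩ := Metric.isOpen_iff.1 hT.isOpen_compl t ht
  filter_upwards [Metric.ball_mem_nhds t hε] with u hu
  have : T ∩ Ici u = T ∩ Ici t := by
    ext v
    simp only [mem_inter_iff, mem_Ici, and_congr_right_iff]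
    intro hv
    have h1 : ε ≤ |v - t| := by
      by_contra h
      exact hb (show v ∈ Metric.ball t ε from not_le.1 h) hv
    rw [Metric.mem_ball, Real.dist_eq, abs_lt] at hu
    rcases le_abs.1 h1 with h | h <;> constructor <;> intro _ <;> linarith
  rw [ceilT.eq_1 T u, this, ceilT.eq_1 T t]

theorem rho_ceilT_le (hT : IsClosed T) (hs : s ∈ T) (hst : s ≤ t) : rho T (ceilT T t) ≤ t := by
  by_contra h
  rw [not_le] at h
  have h1 := ceilT_le (rho_mem hT (ceilT_mem hT ⟨s, hs⟩ t)) h.le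
  have h3 : t < ceilT T t := h.trans_le rho_le
  have h4 : (T ∩ Iio (ceilT T t)).Nonempty := ⟨s, hs, hst.trans_lt h3⟩
  have h5 : rho T (ceilT T t) ≤ t := by
    rw [rho, if_pos h4]
    refine csSup_le h4 fun u hu => ?_
    by_contra hlt
    exact absurd (ceilT_le hu.1 (not_le.1 hlt).le) (not_le.2 hu.2)
  exact absurd h5 (not_le.2 h)

/-- For a function with `F(ρ(p)) = F(p)`, the extension `F ∘ ceilT T` at `t` is a value of `F` at a
point of `T` at most as far from `x` as `t` is. -/
theorem exists_mem_eq_comp_ceilT (hT : IsClosed T) {E : Type*} {F : ℝ → E} {x b : ℝ} (hx : x ∈ T)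
    (hb : b ∈ T) (hF : ∀ p ∈ T, x < p → F (rho T p) = F p) (htb : t ≤ b) :
    ∃ q ∈ T, |q - x| ≤ |t - x| ∧ F (ceilT T t) = F q := by
  rcases le_or_gt t x with htx | htx
  · refine ⟨ceilT T t, ceilT_mem hT ⟨x, hx⟩ t, ?_, rfl⟩
    have h1 := le_ceilT hx htx
    have h2 := ceilT_le hx htx
    rw [abs_of_nonpos (by linarith), abs_of_nonpos (by linarith)]
    linarith
  · have hc := ceilT_mem hT ⟨x, hx⟩ t
    have hxc : x < ceilT T t := htx.trans_le (le_ceilT hb htb)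
    refine ⟨rho T (ceilT T t), rho_mem hT hc, ?_, (hF _ hc hxc).symm⟩
    have h1 := rho_ceilT_le hT hx htx.le
    have h2 := le_rho hx hxc
    rw [abs_of_nonneg (by linarith), abs_of_nonneg (by linarith)]
    linarith

/-! ### Nabla differentiation -/

/-- The nabla derivative decomposed into continuity, the jump equation, and the ordinary
derivative at left-dense points. -/
theorem hasNablaDeriv_iff (hs : s ∈ T) : HasNablaDeriv T f d s ↔
    ContinuousWithinAt f T s ∧ f s - f (rho T s) = d * nu T s ∧
      (rho T s = s → HasDerivWithinAt f d T s) := by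
  have hbound : HasNablaDeriv T f d s → f s - f (rho T s) = d * nu T s := by
    intro h
    have h1 : |f (rho T s) - f s - d * (rho T s - s)| ≤ 0 := by
      refine le_of_forall_pos_le_add fun ε hε => ?_
      have h2 := (h (ε / (|rho T s - s| + 1)) (by positivity)).self_of_nhdsWithin hs
      refine h2.trans ?_
      rw [zero_add, div_mul_eq_mul_div, div_le_iff₀ (by positivity)]
      nlinarith [abs_nonneg (rho T s - s)]
    have h2 := abs_nonpos_iff.1 h1
    rw [nu]
    linarith
  constructor
  · intro h
    have hj := hbound h
    refine ⟨?_, hj, fun hr => ?_⟩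
    · rw [ContinuousWithinAt, Metric.tendsto_nhds]
      intro ε hε
      have hd : ∀ᶠ t in 𝓝[T] s, |t - s| < min 1 (ε / (2 * (|rho T s - s| + 1 + |d|))) := by
        have : Metric.ball s (min 1 (ε / (2 * (|rho T s - s| + 1 + |d|)))) ∈ 𝓝[T] s :=
          mem_nhdsWithin_of_mem_nhds (Metric.ball_mem_nhds _ (by positivity))
        filter_upwards [this] with t ht
        exact ht
      filter_upwards [h (ε / (2 * (|rho T s - s| + 1 + |d|))) (by positivity), hd] with t h1 h2
      rw [lt_min_iff] at h2
      set δ := ε / (2 * (|rho T s - s| + 1 + |d|)) with hδ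
      have hδ0 : 0 < δ := by positivity
      have h3 : |rho T s - t| ≤ |rho T s - s| + 1 := by
        have : rho T s - t = (rho T s - s) - (t - s) := by ring
        rw [this]
        exact (abs_sub _ _).trans (by linarith)
      have h4 : f t - f s = -(f (rho T s) - f t - d * (rho T s - t)) + d * (t - s) := by
        rw [nu] at hj
        linarith
      rw [Real.dist_eq, h4]
      have h5 := abs_add_le (-(f (rho T s) - f t - d * (rho T s - t))) (d * (t - s))
      rw [abs_neg, abs_mul] at h5
      have h6 : δ * |rho T s - t| ≤ δ * (|rho T s - s| + 1) :=
        mul_le_mul_of_nonneg_left h3 hδ0.le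
      have h7 : |d| * |t - s| ≤ |d| * δ := mul_le_mul_of_nonneg_left h2.2.le (abs_nonneg d)
      have h8 : δ * (|rho T s - s| + 1 + |d|) = ε / 2 := by
        rw [hδ]
        field_simp
      nlinarith
    · rw [hasDerivWithinAt_iff_isLittleO, Asymptotics.isLittleO_iff]
      intro c hc
      filter_upwards [h c hc] with t ht
      rw [hr] at ht
      rw [Real.norm_eq_abs, Real.norm_eq_abs, abs_sub_comm t s, smul_eq_mul]
      convert ht using 1
      rw [← abs_neg]
      ring_nf
  · rintro ⟨hc, hj, hd⟩ ε hε
    rcases (rho_le (T := T) (s := s)).eq_or_lt with hr | hr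
    · have := hd hr
      rw [hasDerivWithinAt_iff_isLittleO, Asymptotics.isLittleO_iff] at this
      filter_upwards [this hε] with t ht
      rw [hr]
      rw [Real.norm_eq_abs, Real.norm_eq_abs, abs_sub_comm t s, smul_eq_mul] at ht
      convert ht using 1
      rw [← abs_neg]
      ring_nf
    · have h1 : Tendsto (fun t => |f (rho T s) - f t - d * (rho T s - t)|) (𝓝[T] s)
          (𝓝 |f (rho T s) - f s - d * (rho T s - s)|) :=
        ((tendsto_const_nhds.sub hc).sub (tendsto_const_nhds.mul
          (tendsto_const_nhds.sub (tendsto_id.mono_left nhdsWithin_le_nhds)))).abs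
      have h2 : Tendsto (fun t => ε * |rho T s - t|) (𝓝[T] s) (𝓝 (ε * |rho T s - s|)) :=
        tendsto_const_nhds.mul
          (tendsto_const_nhds.sub (tendsto_id.mono_left nhdsWithin_le_nhds)).abs
      have h3 : f (rho T s) - f s - d * (rho T s - s) = 0 := by
        rw [nu] at hj
        linarith
      refine (h1.eventually_lt h2 ?_).mono fun t ht => ht.le
      rw [h3, abs_zero]
      exact mul_pos hε (abs_pos.2 (sub_ne_zero.2 hr.ne))

theorem HasNablaDeriv.continuousWithinAt (hs : s ∈ T) (h : HasNablaDeriv T f d s) :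
    ContinuousWithinAt f T s :=
  ((hasNablaDeriv_iff hs).1 h).1

theorem HasNablaDeriv.sub_rho (hs : s ∈ T) (h : HasNablaDeriv T f d s) :
    f s - f (rho T s) = d * nu T s :=
  ((hasNablaDeriv_iff hs).1 h).2.1

theorem hasNablaDeriv_const (c : ℝ) : HasNablaDeriv T (fun _ => c) 0 s := by
  intro ε hε
  refine Eventually.of_forall fun t => ?_
  simp only [sub_self, zero_mul, abs_zero]
  positivity

theorem HasNablaDeriv.add (hs : s ∈ T) (hf : HasNablaDeriv T f d s) (hg : HasNablaDeriv T g e s) :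
    HasNablaDeriv T (fun t => f t + g t) (d + e) s := by
  rw [hasNablaDeriv_iff hs] at *
  exact ⟨hf.1.add hg.1, by linear_combination hf.2.1 + hg.2.1,
    fun h => (hf.2.2 h).add (hg.2.2 h)⟩

theorem HasNablaDeriv.sub (hs : s ∈ T) (hf : HasNablaDeriv T f d s) (hg : HasNablaDeriv T g e s) :
    HasNablaDeriv T (fun t => f t - g t) (d - e) s := by
  rw [hasNablaDeriv_iff hs] at *
  exact ⟨hf.1.sub hg.1, by linear_combination hf.2.1 - hg.2.1,
    fun h => (hf.2.2 h).sub (hg.2.2 h)⟩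

/-- The product rule `(fg)^∇(s) = f^∇(s) g(s) + f(ρ(s)) g^∇(s)`. -/
theorem HasNablaDeriv.mul (hs : s ∈ T) (hf : HasNablaDeriv T f d s) (hg : HasNablaDeriv T g e s) :
    HasNablaDeriv T (fun t => f t * g t) (d * g s + f (rho T s) * e) s := by
  rw [hasNablaDeriv_iff hs] at *
  refine ⟨hf.1.mul hg.1, by linear_combination g s * hf.2.1 + f (rho T s) * hg.2.1, fun h => ?_⟩
  rw [h]
  exact (hf.2.2 h).mul (hg.2.2 h)

theorem HasNablaDeriv.sum {ι : Type*} (u : Finset ι) {F : ι → ℝ → ℝ} {D : ι → ℝ} (hs : s ∈ T)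
    (h : ∀ i ∈ u, HasNablaDeriv T (F i) (D i) s) :
    HasNablaDeriv T (fun t => ∑ i ∈ u, F i t) (∑ i ∈ u, D i) s := by
  classical
  induction u using Finset.induction_on with
  | empty => simpa using hasNablaDeriv_const 0
  | insert a u ha ih =>
    simp only [Finset.sum_insert ha]
    exact (h a (Finset.mem_insert_self a u)).add hs
      (ih fun i hi => h i (Finset.mem_insert_of_mem hi))

theorem HasNablaDeriv.inter_Icc {a b : ℝ} (h : HasNablaDeriv T f d s) (ha : a ∈ T) (has : a < s)
    (hsb : s ≤ b) : HasNablaDeriv (T ∩ Icc a b) f d s := by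
  intro ε hε
  rw [rho_inter_Icc ha has hsb]
  exact (h ε hε).filter_mono (nhdsWithin_mono s inter_subset_left)

/-- A function that is nabla differentiable on `kappa T` is continuous on `T`. -/
theorem continuousOn_of_hasNablaDeriv {D : ℝ → ℝ} (h : ∀ s ∈ kappa T, HasNablaDeriv T f (D s) s) :
    ContinuousOn f T := by
  intro s hs
  by_cases hk : s ∈ kappa T
  · exact (h s hk).continuousWithinAt hs
  · rw [ContinuousWithinAt, nhdsWithin_eq_pure_of_notMem_kappa hs hk]
    exact tendsto_pure_nhds f s

/-- A continuous function whose nabla derivative vanishes off a countable set of left-dense points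
is constant. Its extension `f ∘ ceilT T` to an interval is continuous, because `f(ρ(s)) = f(s)`, and
has derivative `0` off a countable set. -/
theorem eq_of_hasNablaDeriv_zero (hT : IsClosed T) {a b : ℝ} (ha : a ∈ T) (hb : b ∈ T)
    (hab : a ≤ b) (hf : ContinuousOn f T) {E : Set ℝ} (hE : E.Countable)
    (h : ∀ s ∈ T, a < s → (rho T s < s ∨ s ∉ E) → HasNablaDeriv T f 0 s) : f a = f b := by
  have hjump : ∀ p ∈ T, a < p → f (rho T p) = f p := by
    intro p hp hap
    rcases (rho_le (T := T) (s := p)).eq_or_lt with hr | hr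
    · rw [hr]
    · have := (h p hp hap (Or.inl hr)).sub_rho hp
      linarith
  have hcont : ContinuousOn (fun t => f (ceilT T t)) (Icc a b) := by
    intro x hx
    by_cases hxT : x ∈ T
    · rw [ContinuousWithinAt, Metric.tendsto_nhdsWithin_nhds]
      intro ε hε
      obtain ⟨δ, hδ, hδf⟩ := Metric.continuousWithinAt_iff.1 (hf x hxT) ε hε
      refine ⟨δ, hδ, fun {t} ht htx => ?_⟩
      obtain ⟨q, hq, hqx, hqf⟩ := exists_mem_eq_comp_ceilT hT hxT hb
        (fun p hp hxp => hjump p hp (hx.1.trans_lt hxp)) ht.2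
      rw [hqf, ceilT_self hxT]
      exact hδf hq (lt_of_le_of_lt hqx htx)
    · refine ContinuousAt.continuousWithinAt ?_
      refine (continuousAt_const (y := f (ceilT T x))).congr ?_
      filter_upwards [eventually_ceilT_eq hT hxT] with t ht
      rw [ht]
  have hderiv : ∀ x ∈ Ioo a b \ (E ∪ {x ∈ T | 𝓝[T ∩ Iio x] x = ⊥}),
      HasDerivAt (fun t => f (ceilT T t)) 0 x := by
    rintro x ⟨hx, hxE⟩
    rw [mem_union, not_or] at hxE
    by_cases hxT : x ∈ T
    · have hr : rho T x = x := by
        by_contra hr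
        exact hxE.2 ⟨hxT, nhdsWithin_Iio_eq_bot (lt_of_le_of_ne rho_le hr)⟩
      have hd := h x hxT hx.1 (Or.inr hxE.1)
      rw [hasDerivAt_iff_isLittleO, Asymptotics.isLittleO_iff]
      intro c hc
      obtain ⟨δ, hδ, hδf⟩ := Metric.mem_nhdsWithin_iff.1 (hd c hc)
      filter_upwards [Metric.ball_mem_nhds x hδ, Iio_mem_nhds hx.2] with t ht htb
      obtain ⟨q, hq, hqx, hqf⟩ := exists_mem_eq_comp_ceilT hT hxT hb
        (fun p hp hxp => hjump p hp (hx.1.trans hxp)) (le_of_lt htb)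
      have h1 : |f x - f q| ≤ c * |x - q| := by
        have := hδf ⟨lt_of_le_of_lt hqx ht, hq⟩
        simpa [hr] using this
      rw [hqf, ceilT_self hxT, smul_zero, sub_zero, Real.norm_eq_abs, Real.norm_eq_abs,
        abs_sub_comm]
      refine h1.trans (mul_le_mul_of_nonneg_left ?_ hc.le)
      rwa [abs_sub_comm]
    · refine (hasDerivAt_const x (f (ceilT T x))).congr_of_eventuallyEq ?_
      filter_upwards [eventually_ceilT_eq hT hxT] with t ht
      rw [ht]
  have := MeasureTheory.integral_eq_of_hasDerivAt_off_countable_of_le _ (fun _ => (0 : ℝ)) hab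
    (hE.union countable_setOfPred_isolated_left_within) hcont hderiv intervalIntegrable_const
  simp only [intervalIntegral.integral_zero, ceilT_self ha, ceilT_self hb] at this
  linarith

/-- Constancy on `T ∩ [a, b]`, for a derivative that is taken in `T ∩ [a, b]`. -/
theorem eq_of_hasNablaDeriv_zero_Icc (hT : IsClosed T) {a b : ℝ} (hb : b ∈ T)
    (hf : ContinuousOn f (T ∩ Icc a b)) {E : Set ℝ} (hE : E.Countable)
    (h : ∀ s ∈ T ∩ Ioc a b, (rho T s < s ∨ s ∉ E) → HasNablaDeriv (T ∩ Icc a b) f 0 s)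
    (hs : s ∈ T ∩ Icc a b) : f s = f b := by
  have hset : (T ∩ Icc a b) ∩ Icc s b = T ∩ Icc s b := by
    rw [inter_assoc, inter_eq_right.2 (Icc_subset_Icc_left hs.2.1)]
  refine eq_of_hasNablaDeriv_zero (T := T ∩ Icc s b) (hT.inter isClosed_Icc)
    ⟨hs.1, le_rfl, hs.2.2⟩ ⟨hb, hs.2.2, le_rfl⟩ hs.2.2
    (hf.mono (inter_subset_inter_right _ (Icc_subset_Icc_left hs.2.1))) hE fun u hu hsu hcase => ?_
  rw [rho_inter_Icc hs.1 hsu hu.2.2] at hcase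
  rw [← hset]
  exact (h u ⟨hu.1, hs.2.1.trans_lt hsu, hu.2.2⟩ hcase).inter_Icc hs hsu hu.2.2

/-- A function with vanishing nabla derivative on `kappa T` is constant on `T`. -/
theorem eq_of_hasNablaDeriv_zero_kappa (hT : IsClosed T)
    (h : ∀ s ∈ kappa T, HasNablaDeriv T f 0 s) (hs : s ∈ T) (ht : t ∈ T) : f s = f t := by
  wlog hst : s ≤ t generalizing s t with H
  · exact (H ht hs (le_of_not_ge hst)).symm
  refine eq_of_hasNablaDeriv_zero_Icc hT ht
    ((continuousOn_of_hasNablaDeriv h).mono inter_subset_left) (E := ∅) countable_empty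
    (fun u hu _ => ?_) ⟨hs, le_rfl, hst⟩
  exact (h u (mem_kappa_of_lt hs hu.1 hu.2.1)).inter_Icc hs hu.2.1 hu.2.2

/-! ### Functions that are continuous at left-dense points and have right limits -/

/-- Ld-continuity for functions with values in any topological space. The right limit is required
at every point; at right-scattered points this is no condition. -/
def LdCont {X : Type*} [TopologicalSpace X] (T : Set ℝ) (f : ℝ → X) : Prop :=
  ∀ s ∈ T, (rho T s = s → ContinuousWithinAt f T s) ∧ ∃ l, Tendsto f (𝓝[T ∩ Ioi s] s) (𝓝 l)

theorem ldContinuous_iff_ldCont {f : ℝ → ℝ} : LdContinuous T f ↔ LdCont T f := by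
  refine forall₂_congr fun s _ => and_congr_right fun _ => ⟨fun h => ?_, fun h _ => h⟩
  rcases (le_sigma (T := T) (s := s)).eq_or_lt with hσ | hσ
  · exact h hσ.symm
  · exact ⟨0, by rw [nhdsWithin_Ioi_eq_bot hσ]; exact tendsto_bot⟩

section General

variable {X Y Z : Type*} [TopologicalSpace X] [TopologicalSpace Y] [TopologicalSpace Z]

theorem LdCont.comp_continuous {f : ℝ → X} (hf : LdCont T f) {φ : X → Y} (hφ : Continuous φ) :
    LdCont T (fun t => φ (f t)) := fun s hs =>
  ⟨fun h => hφ.continuousAt.comp_continuousWithinAt ((hf s hs).1 h),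
    (hf s hs).2.elim fun l hl => ⟨φ l, (hφ.tendsto l).comp hl⟩⟩

theorem LdCont.prodMk {f : ℝ → X} {g : ℝ → Y} (hf : LdCont T f) (hg : LdCont T g) :
    LdCont T (fun t => (f t, g t)) := fun s hs =>
  ⟨fun h => ((hf s hs).1 h).prodMk ((hg s hs).1 h),
    (hf s hs).2.elim fun l hl => (hg s hs).2.elim fun l' hl' => ⟨(l, l'), hl.prodMk_nhds hl'⟩⟩

theorem LdCont.comp₂ {f : ℝ → X} {g : ℝ → Y} (hf : LdCont T f) (hg : LdCont T g) {φ : X → Y → Z}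
    (hφ : Continuous fun p : X × Y => φ p.1 p.2) : LdCont T (fun t => φ (f t) (g t)) :=
  (hf.prodMk hg).comp_continuous hφ

theorem ldCont_const (c : X) : LdCont T (fun _ => c) := fun _ _ =>
  ⟨fun _ => continuousWithinAt_const, c, tendsto_const_nhds⟩

theorem ldCont_of_continuousOn {f : ℝ → X} (hf : ContinuousOn f T) : LdCont T f := fun s hs =>
  ⟨fun _ => hf s hs, f s, (hf s hs).mono_left (nhdsWithin_mono s inter_subset_left)⟩

/-- The backward jump operator is continuous at left-dense points and from the right. -/
theorem tendsto_rho_of_tendsto {l : Filter ℝ} (hs : s ∈ T) (hl : l ≤ 𝓝[T] s)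
    (h : rho T s = s ∨ ∀ᶠ t in l, s < t) : Tendsto (rho T) l (𝓝 s) := by
  have hid : Tendsto id l (𝓝 s) := hl.trans nhdsWithin_le_nhds
  rcases h with h | h
  · rw [tendsto_order]
    refine ⟨fun a has => ?_, fun b hb => ?_⟩
    · by_cases hne : (T ∩ Iio s).Nonempty
      · rw [rho, if_pos hne] at h
        rw [← h] at has
        obtain ⟨u, hu, hau⟩ := exists_lt_of_lt_csSup hne has
        filter_upwards [hid (Ioi_mem_nhds hu.2)] with t ht
        exact hau.trans_le (le_rho hu.1 ht)
      · filter_upwards [hl self_mem_nhdsWithin] with t ht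
        have hst : s ≤ t := by
          by_contra hlt
          exact hne ⟨t, ht, not_le.1 hlt⟩
        rcases hst.eq_or_lt with rfl | hst
        · rwa [h]
        · exact has.trans_le (le_rho hs hst)
    · filter_upwards [hid (Iio_mem_nhds hb)] with t ht
      exact rho_le.trans_lt ht
  · refine tendsto_of_tendsto_of_tendsto_of_le_of_le' tendsto_const_nhds hid ?_
      (Eventually.of_forall fun t => rho_le)
    filter_upwards [h] with t ht
    exact le_rho hs ht

theorem ldCont_comp_rho_of_continuousOn (hT : IsClosed T) {f : ℝ → X} (hf : ContinuousOn f T) :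
    LdCont T (fun t => f (rho T t)) := by
  intro s hs
  have hr : ∀ l : Filter ℝ, l ≤ 𝓝[T] s → (rho T s = s ∨ ∀ᶠ t in l, s < t) →
      Tendsto (rho T) l (𝓝[T] s) := fun l hl h =>
    tendsto_nhdsWithin_iff.2 ⟨tendsto_rho_of_tendsto hs hl h,
      (show ∀ᶠ t in l, t ∈ T from hl self_mem_nhdsWithin).mono fun t ht => rho_mem hT ht⟩
  refine ⟨fun h => ?_, f s, ?_⟩
  · rw [ContinuousWithinAt, h]
    exact (hf s hs).tendsto.comp (hr _ le_rfl (Or.inl h))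
  · refine (hf s hs).tendsto.comp (hr _ (nhdsWithin_mono s inter_subset_left) (Or.inr ?_))
    filter_upwards [self_mem_nhdsWithin] with t ht
    exact ht.2

/-- At a left-dense point and to the right of a right-dense point, the graininess tends to `0`. -/
theorem tendsto_nu_of_tendsto {l : Filter ℝ} (hs : s ∈ T) (hl : l ≤ 𝓝[T] s)
    (h : rho T s = s ∨ ∀ᶠ t in l, s < t) : Tendsto (nu T) l (𝓝 0) := by
  have hid : Tendsto id l (𝓝 s) := hl.trans nhdsWithin_le_nhds
  have := hid.sub (tendsto_rho_of_tendsto hs hl h)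
  rwa [sub_self] at this

/-- The extension of an ld-continuous function to the line is left-continuous. -/
theorem LdCont.continuousWithinAt_comp_ceilT (hT : IsClosed T) (hne : T.Nonempty) {f : ℝ → X}
    (hf : LdCont T f) (t : ℝ) : ContinuousWithinAt (fun u => f (ceilT T u)) (Iic t) t := by
  by_cases ht : t ∈ T
  · rcases (rho_le (T := T) (s := t)).eq_or_lt with hr | hr
    · have h1 : Tendsto (ceilT T) (𝓝[Iic t] t) (𝓝[T] t) := by
        refine tendsto_nhdsWithin_iff.2 ⟨?_, Eventually.of_forall fun u => ceilT_mem hT hne u⟩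
        refine tendsto_of_tendsto_of_tendsto_of_le_of_le'
          (tendsto_id.mono_left nhdsWithin_le_nhds) tendsto_const_nhds ?_ ?_
        · filter_upwards [self_mem_nhdsWithin] with u hu
          exact le_ceilT ht hu
        · filter_upwards [self_mem_nhdsWithin] with u hu
          exact ceilT_le ht hu
      rw [ContinuousWithinAt, ceilT_self ht]
      exact ((hf t ht).1 hr).tendsto.comp h1
    · refine (continuousWithinAt_const (b := f t)).congr_of_eventuallyEq ?_ (by rw [ceilT_self ht])
      filter_upwards [self_mem_nhdsWithin, mem_nhdsWithin_of_mem_nhds (Ioi_mem_nhds hr)]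
        with u hu hu'
      rw [ceilT_eq hT ht hu' hu]
  · refine ContinuousAt.continuousWithinAt ?_
    refine (continuousAt_const (y := f (ceilT T t))).congr ?_
    filter_upwards [eventually_ceilT_eq hT ht] with u hu
    rw [hu]

end General

open MeasureTheory

/-- A left-continuous function is measurable, as a limit of step functions. -/
theorem stronglyMeasurable_of_continuousWithinAt_Iic {X : Type*} [TopologicalSpace X]
    [TopologicalSpace.PseudoMetrizableSpace X] {f : ℝ → X}
    (hf : ∀ t, ContinuousWithinAt f (Iic t) t) : StronglyMeasurable f := by
  have hlim : ∀ t : ℝ, Tendsto (fun n : ℕ => ((⌈((n : ℝ) + 1) * t⌉ : ℝ) - 1) / ((n : ℝ) + 1)) atTop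
      (𝓝[Iic t] t) := by
    intro t
    have hb : ∀ n : ℕ, t - 1 / ((n : ℝ) + 1) ≤ ((⌈((n : ℝ) + 1) * t⌉ : ℝ) - 1) / ((n : ℝ) + 1) ∧
        ((⌈((n : ℝ) + 1) * t⌉ : ℝ) - 1) / ((n : ℝ) + 1) ≤ t := by
      intro n
      have hn : (0 : ℝ) < (n : ℝ) + 1 := by positivity
      have h1 := Int.le_ceil (((n : ℝ) + 1) * t)
      have h2 := Int.ceil_lt_add_one (((n : ℝ) + 1) * t)
      constructor
      · rw [le_div_iff₀ hn, sub_mul, one_div, inv_mul_cancel₀ hn.ne']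
        linarith
      · rw [div_le_iff₀ hn]
        linarith
    refine tendsto_nhdsWithin_iff.2 ⟨?_, Eventually.of_forall fun n => (hb n).2⟩
    refine tendsto_of_tendsto_of_tendsto_of_le_of_le ?_ tendsto_const_nhds
      (fun n => (hb n).1) (fun n => (hb n).2)
    simpa using (tendsto_const_nhds (x := t)).sub tendsto_one_div_add_atTop_nhds_zero_nat
  refine stronglyMeasurable_of_tendsto atTop
    (f := fun (n : ℕ) t => f (((⌈((n : ℝ) + 1) * t⌉ : ℝ) - 1) / ((n : ℝ) + 1))) (fun n => ?_)
    (tendsto_pi_nhds.2 fun t => (hf t).tendsto.comp (hlim t))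
  have h1 : StronglyMeasurable fun k : ℤ => f (((k : ℝ) - 1) / ((n : ℝ) + 1)) :=
    StronglyMeasurable.of_discrete
  exact h1.comp_measurable (Int.measurable_ceil.comp (measurable_const_mul _))

theorem LdCont.stronglyMeasurable_comp_ceilT {X : Type*} [TopologicalSpace X]
    [TopologicalSpace.PseudoMetrizableSpace X] (hT : IsClosed T) (hne : T.Nonempty) {f : ℝ → X}
    (hf : LdCont T f) : StronglyMeasurable fun u => f (ceilT T u) :=
  stronglyMeasurable_of_continuousWithinAt_Iic (hf.continuousWithinAt_comp_ceilT hT hne)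

theorem LdCont.bounded_comp_ceilT {E : Type*} [SeminormedAddCommGroup E] (hT : IsClosed T)
    (hne : T.Nonempty) {f : ℝ → E} (hf : LdCont T f) (a b : ℝ) :
    ∃ C, ∀ t ∈ Icc a b, ‖f (ceilT T t)‖ ≤ C := by
  have hcomp : IsCompact (T ∩ Icc (ceilT T a) (ceilT T b)) := isCompact_Icc.inter_left hT
  obtain ⟨C, hC⟩ : ∃ C, ∀ t ∈ T ∩ Icc (ceilT T a) (ceilT T b), ‖f t‖ ≤ C := by
    refine hcomp.induction_on (p := fun K => ∃ C, ∀ t ∈ K, ‖f t‖ ≤ C) ⟨0, by simp⟩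
      (fun K L hKL ⟨C, hC⟩ => ⟨C, fun t ht => hC t (hKL ht)⟩)
      (fun K L ⟨C, hC⟩ ⟨D, hD⟩ => ⟨max C D, fun t ht => ht.elim
        (fun h => (hC t h).trans (le_max_left _ _)) (fun h => (hD t h).trans (le_max_right _ _))⟩)
      fun s hs => ?_
    suffices H : ∃ C, ∀ᶠ t in 𝓝[T] s, ‖f t‖ ≤ C by
      obtain ⟨C, hC⟩ := H
      exact ⟨_, nhdsWithin_mono s inter_subset_left hC, C, fun t ht => ht⟩
    have hlim : ∀ {l : Filter ℝ} {x : E}, Tendsto f l (𝓝 x) → ∀ᶠ t in l, ‖f t‖ ≤ ‖x‖ + 1 :=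
      fun h => (h.norm.eventually_lt_const (lt_add_one _)).mono fun t ht => ht.le
    rcases (rho_le (T := T) (s := s)).eq_or_lt with hr | hr
    · exact ⟨_, hlim ((hf s hs.1).1 hr)⟩
    · obtain ⟨l, hl⟩ := (hf s hs.1).2
      refine ⟨max ‖f s‖ (‖l‖ + 1), ?_⟩
      have h1 := eventually_nhdsWithin_iff.1 (hlim hl)
      rw [eventually_nhdsWithin_iff]
      filter_upwards [h1, Ioi_mem_nhds hr] with t ht htr htT
      rcases lt_trichotomy t s with hts | rfl | hts
      · exact absurd (le_rho htT hts) (not_le.2 htr)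
      · exact le_max_left _ _
      · exact (ht ⟨htT, hts⟩).trans (le_max_right _ _)
  exact ⟨C, fun t ht => hC _ ⟨ceilT_mem hT hne t, ceilT_mono hT hne ht.1, ceilT_mono hT hne ht.2⟩⟩

theorem LdCont.intervalIntegrable_comp_ceilT {E : Type*} [NormedAddCommGroup E] (hT : IsClosed T)
    (hne : T.Nonempty) {f : ℝ → E} (hf : LdCont T f) (a b : ℝ) :
    IntervalIntegrable (fun t => f (ceilT T t)) volume a b := by
  obtain ⟨C, hC⟩ := hf.bounded_comp_ceilT hT hne (min a b) (max a b)
  refine (intervalIntegrable_const (c := C)).mono_fun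
    (hf.stronglyMeasurable_comp_ceilT hT hne).aestronglyMeasurable ?_
  refine (ae_restrict_iff' measurableSet_uIoc).2 (Eventually.of_forall fun t ht => ?_)
  exact (hC t (Ioc_subset_Icc_self ht)).trans (Real.le_norm_self C)

/-- The fundamental theorem of calculus for the nabla integral. -/
theorem LdCont.hasNablaDeriv_integral (hT : IsClosed T) {f : ℝ → ℝ} (hf : LdCont T f) (z : ℝ)
    (hs : s ∈ T) : HasNablaDeriv T (fun u => ∫ t in z..u, f (ceilT T t)) (f s) s := by
  have hint := hf.intervalIntegrable_comp_ceilT hT ⟨s, hs⟩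
  have hsub : ∀ u, (∫ t in z..u, f (ceilT T t)) - ∫ t in z..s, f (ceilT T t) =
      ∫ t in s..u, f (ceilT T t) := fun u =>
    intervalIntegral.integral_interval_sub_left (hint _ _) (hint _ _)
  rw [hasNablaDeriv_iff hs]
  refine ⟨(intervalIntegral.continuous_primitive hint z).continuousWithinAt, ?_, fun hr => ?_⟩
  · have h1 : ∫ t in s..rho T s, f (ceilT T t) = ∫ t in s..rho T s, f s := by
      refine intervalIntegral.integral_congr_ae (Eventually.of_forall fun t ht => ?_)
      rw [uIoc_of_ge rho_le] at ht
      rw [ceilT_eq hT hs ht.1 ht.2]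
    have h2 := hsub (rho T s)
    rw [h1, intervalIntegral.integral_const, smul_eq_mul] at h2
    rw [nu]
    linarith
  · rw [hasDerivWithinAt_iff_isLittleO, Asymptotics.isLittleO_iff]
    intro c hc
    obtain ⟨δ, hδ, hδf⟩ := Metric.continuousWithinAt_iff.1 ((hf s hs).1 hr) c hc
    filter_upwards [self_mem_nhdsWithin, mem_nhdsWithin_of_mem_nhds (Metric.ball_mem_nhds s hδ)]
      with u hu hus
    have h1 : (u - s) • f s = ∫ t in s..u, f s := by rw [intervalIntegral.integral_const]
    rw [hsub, h1, ← intervalIntegral.integral_sub (hint _ _) intervalIntegrable_const]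
    refine (intervalIntegral.norm_integral_le_of_norm_le_const fun t ht => ?_).trans_eq
      (by rw [Real.norm_eq_abs])
    -- between two points of `T`, rounding up does not leave the interval
    refine (hδf (ceilT_mem hT ⟨s, hs⟩ t) (lt_of_le_of_lt ?_ hus)).le
    rw [Real.dist_eq, Real.dist_eq]
    rcases le_total s u with h | h
    · rw [uIoc_of_le h] at ht
      have h2 := le_ceilT hu ht.2
      have h3 := ceilT_le hu ht.2
      rw [abs_of_nonneg (by linarith [ht.1]), abs_of_nonneg (by linarith)]
      linarith
    · rw [uIoc_of_ge h] at ht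
      have h2 := le_ceilT hs ht.2
      have h3 := ceilT_le hs ht.2
      rw [abs_of_nonpos (by linarith), abs_of_nonpos (by linarith)]
      linarith [ht.1]

/-! ### A Volterra equation with deviating argument -/

section Volterra

open MeasureTheory

variable {E : Type*} [NormedAddCommGroup E] [NormedSpace ℝ E]

/-- The terms of the Peano–Baker series of `y(s) = x₀ + ∫_z^s K(t) y(τ(t)) dt`. -/
noncomputable def volterraTerm (K : ℝ → E →L[ℝ] E) (τ : ℝ → ℝ) (z : ℝ) (x₀ : E) : ℕ → ℝ → E
  | 0, _ => x₀
  | k + 1, s => ∫ t in z..s, K t (volterraTerm K τ z x₀ k (τ t))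

variable {K : ℝ → E →L[ℝ] E} {τ : ℝ → ℝ}

theorem intervalIntegrable_volterra (hτ : ∀ t, |τ t - z| ≤ |t - z|)
    (hbd : ∀ R, ∃ C, ∀ t, |t - z| ≤ R → ∀ v, ‖K t v‖ ≤ C * ‖v‖)
    (hmeas : ∀ u : ℝ → E, Continuous u → AEStronglyMeasurable (fun t => K t (u (τ t))) volume)
    {u : ℝ → E} (hu : Continuous u) (a b : ℝ) :
    IntervalIntegrable (fun t => K t (u (τ t))) volume a b := by
  set R := max |a - z| |b - z| with hR
  obtain ⟨C, hC⟩ := hbd R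
  obtain ⟨D, hD⟩ := (isCompact_closedBall z R).exists_bound_of_continuousOn hu.continuousOn
  refine (intervalIntegrable_const (c := |C| * D)).mono_fun (hmeas u hu).restrict ?_
  refine (ae_restrict_iff' measurableSet_uIoc).2 (Eventually.of_forall fun t ht => ?_)
  have htR : |t - z| ≤ R := by
    have h1 : z - R ≤ min a b := le_min
      (by linarith [neg_abs_le (a - z), le_max_left |a - z| |b - z|])
      (by linarith [neg_abs_le (b - z), le_max_right |a - z| |b - z|])
    have h2 : max a b ≤ z + R := max_le
      (by linarith [le_abs_self (a - z), le_max_left |a - z| |b - z|])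
      (by linarith [le_abs_self (b - z), le_max_right |a - z| |b - z|])
    rw [abs_le]
    constructor <;> linarith [ht.1, ht.2]
  refine (hC t htR _).trans (le_trans ?_ (Real.le_norm_self _))
  exact mul_le_mul (le_abs_self C) (hD _ ((hτ t).trans htR)) (norm_nonneg _) (abs_nonneg C)

theorem continuous_volterraTerm (hτ : ∀ t, |τ t - z| ≤ |t - z|)
    (hbd : ∀ R, ∃ C, ∀ t, |t - z| ≤ R → ∀ v, ‖K t v‖ ≤ C * ‖v‖)
    (hmeas : ∀ u : ℝ → E, Continuous u → AEStronglyMeasurable (fun t => K t (u (τ t))) volume)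
    (x₀ : E) (k : ℕ) : Continuous (volterraTerm K τ z x₀ k) := by
  induction k with
  | zero => exact continuous_const
  | succ k ih =>
    exact intervalIntegral.continuous_primitive
      (fun a b => intervalIntegrable_volterra hτ hbd hmeas ih a b) z

theorem norm_volterraTerm_le (hτ : ∀ t, |τ t - z| ≤ |t - z|) {R C : ℝ} (hC0 : 0 ≤ C)
    (hC : ∀ t, |t - z| ≤ R → ∀ v, ‖K t v‖ ≤ C * ‖v‖) (x₀ : E) (k : ℕ) :
    ∀ s, |s - z| ≤ R → ‖volterraTerm K τ z x₀ k s‖ ≤ ‖x₀‖ * ((C * |s - z|) ^ k / k.factorial) := by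
  induction k with
  | zero => intro s _; simp [volterraTerm]
  | succ k ih =>
    intro s hs
    have hts : ∀ t ∈ uIoc z s, |t - z| ≤ |s - z| := fun t ht =>
      abs_sub_left_of_mem_uIcc (uIoc_subset_uIcc ht)
    have h1 : ∀ t ∈ uIoc z s, ‖K t (volterraTerm K τ z x₀ k (τ t))‖ ≤
        ‖x₀‖ * C ^ (k + 1) / k.factorial * |t - z| ^ k := by
      intro t ht
      have htR := (hts t ht).trans hs
      calc ‖K t (volterraTerm K τ z x₀ k (τ t))‖
          ≤ C * (‖x₀‖ * ((C * |τ t - z|) ^ k / k.factorial)) :=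
            (hC t htR _).trans (mul_le_mul_of_nonneg_left (ih _ ((hτ t).trans htR)) hC0)
        _ ≤ C * (‖x₀‖ * ((C * |t - z|) ^ k / k.factorial)) := by
            gcongr C * (‖x₀‖ * ((C * ?_) ^ k / _))
            exact hτ t
        _ = _ := by rw [mul_pow]; ring
    have h2 : ‖volterraTerm K τ z x₀ (k + 1) s‖ ≤
        ∫ t in uIoc z s, ‖x₀‖ * C ^ (k + 1) / k.factorial * |t - z| ^ k := by
      rw [volterraTerm, intervalIntegral.norm_intervalIntegral_eq]
      refine norm_integral_le_of_norm_le ?_ ((ae_restrict_iff' measurableSet_uIoc).2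
        (Eventually.of_forall h1))
      exact Continuous.integrableOn_uIoc (by fun_prop)
    refine h2.trans_eq ?_
    rw [integral_const_mul, integral_pow_abs_sub_uIoc, mul_pow, Nat.factorial_succ]
    push_cast
    field_simp

/-- The Volterra equation `y(s) = x₀ + ∫_z^s K(t) y(τ(t)) dt` has a solution on the whole line if
the argument `τ(t)` is never farther from `z` than `t`. -/
theorem exists_volterra [CompleteSpace E] (hτ : ∀ t, |τ t - z| ≤ |t - z|)
    (hbd : ∀ R, ∃ C, ∀ t, |t - z| ≤ R → ∀ v, ‖K t v‖ ≤ C * ‖v‖)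
    (hmeas : ∀ u : ℝ → E, Continuous u → AEStronglyMeasurable (fun t => K t (u (τ t))) volume)
    (x₀ : E) : ∃ y : ℝ → E, Continuous y ∧ ∀ s, y s = x₀ + ∫ t in z..s, K t (y (τ t)) := by
  set Y := volterraTerm K τ z x₀ with hY
  have hYc : ∀ k, Continuous (Y k) := continuous_volterraTerm hτ hbd hmeas x₀
  have hbound : ∀ R, 0 ≤ R → ∃ C, 0 ≤ C ∧ (∀ t, |t - z| ≤ R → ∀ v, ‖K t v‖ ≤ C * ‖v‖) ∧
      ∀ k s, |s - z| ≤ R → ‖Y k s‖ ≤ ‖x₀‖ * ((C * R) ^ k / k.factorial) := by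
    intro R hR
    obtain ⟨C, hC⟩ := hbd R
    have hC' : ∀ t, |t - z| ≤ R → ∀ v, ‖K t v‖ ≤ |C| * ‖v‖ := fun t ht v =>
      (hC t ht v).trans (mul_le_mul_of_nonneg_right (le_abs_self C) (norm_nonneg v))
    refine ⟨|C|, abs_nonneg C, hC', fun k s hs => ?_⟩
    refine (norm_volterraTerm_le hτ (abs_nonneg C) hC' x₀ k s hs).trans ?_
    gcongr
  have hsummable : ∀ C R : ℝ, Summable fun k : ℕ => ‖x₀‖ * ((C * R) ^ k / k.factorial) :=
    fun C R => (Real.summable_pow_div_factorial (C * R)).mul_left _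
  have hsum : ∀ s, HasSum (fun k => Y k s) (∑' k, Y k s) := by
    intro s
    obtain ⟨C, -, -, hC⟩ := hbound |s - z| (abs_nonneg _)
    exact (Summable.of_norm_bounded (hsummable C _) fun k => hC k s le_rfl).hasSum
  have hcont : Continuous fun s => ∑' k, Y k s := by
    refine continuous_iff_continuousAt.2 fun s => ?_
    obtain ⟨C, -, -, hC⟩ := hbound (|s - z| + 1) (by positivity)
    have h1 : ContinuousOn (fun s => ∑' k, Y k s) (Metric.closedBall z (|s - z| + 1)) :=
      continuousOn_tsum (fun k => (hYc k).continuousOn) (hsummable C _) fun k t ht => hC k t ht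
    refine h1.continuousAt (mem_of_superset (Metric.ball_mem_nhds s one_pos) fun t ht => ?_)
    rw [Metric.mem_ball, Real.dist_eq] at ht
    rw [Metric.mem_closedBall, Real.dist_eq]
    have := abs_sub_le t s z
    linarith
  refine ⟨fun s => ∑' k, Y k s, hcont, fun s => ?_⟩
  obtain ⟨C, hC0, hCK, hC⟩ := hbound |s - z| (abs_nonneg _)
  have hts : ∀ t ∈ uIoc z s, |t - z| ≤ |s - z| := fun t ht =>
    abs_sub_left_of_mem_uIcc (uIoc_subset_uIcc ht)
  have h1 : HasSum (fun k => ∫ t in z..s, K t (Y k (τ t)))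
      (∫ t in z..s, K t (∑' k, Y k (τ t))) := by
    refine intervalIntegral.hasSum_integral_of_dominated_convergence
      (fun k _ => C * (‖x₀‖ * ((C * |s - z|) ^ k / k.factorial)))
      (fun k => (hmeas _ (hYc k)).restrict) (fun k => Eventually.of_forall fun t ht => ?_)
      (Eventually.of_forall fun t _ => (hsummable C _).mul_left C) intervalIntegrable_const
      (Eventually.of_forall fun t _ => (K t).hasSum (hsum _))
    exact (hCK t (hts t ht) _).trans
      (mul_le_mul_of_nonneg_left (hC k _ ((hτ t).trans (hts t ht))) hC0)
  have h2 := (hasSum_nat_add_iff' 1).2 (hsum s)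
  have h3 := h2.unique h1
  rw [Finset.sum_range_one] at h3
  rw [← h3, show Y 0 s = x₀ from rfl]
  abel

end Volterra

/-! ### Linear equations and the transition function -/

section Linear

variable {n : ℕ} {A : ℝ → Matrix (Fin n) (Fin n) ℝ}

theorem ldCont_matrix {k l : ℕ} {D : ℝ → Matrix (Fin k) (Fin l) ℝ}
    (h : ∀ i j, LdCont T fun s => D s i j) : LdCont T D := by
  intro s hs
  refine ⟨fun hr => ?_, ?_⟩
  · exact tendsto_pi_nhds.2 fun i => tendsto_pi_nhds.2 fun j => (h i j s hs).1 hr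
  · choose l hl using fun i j => (h i j s hs).2
    exact ⟨Matrix.of l, tendsto_pi_nhds.2 fun i => tendsto_pi_nhds.2 fun j => hl i j⟩

theorem LdCont.entry {k l : ℕ} {D : ℝ → Matrix (Fin k) (Fin l) ℝ} (h : LdCont T D) (i : Fin k)
    (j : Fin l) : LdCont T fun s => D s i j :=
  h.comp_continuous (continuous_id.matrix_elem i j)

/-- The resolvent `(I - ν A)⁻¹` of an ld-continuous `A` is ld-continuous: at the points where this
is a condition, `I - ν A` tends to `I`. -/
theorem LdCont.resolvent (hA : LdCont T A) : LdCont T fun s => (1 - nu T s • A s)⁻¹ := by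
  have hinv : Tendsto (fun M : Matrix (Fin n) (Fin n) ℝ => M⁻¹) (𝓝 1) (𝓝 1) := by
    have h : ContinuousAt (fun M : Matrix (Fin n) (Fin n) ℝ => M⁻¹) 1 := by
      refine continuousAt_matrix_inv 1 ?_
      rw [Ring.inverse_eq_inv', Matrix.det_one]
      exact continuousAt_inv₀ one_ne_zero
    have h1 := h.tendsto
    rwa [inv_one] at h1
  have key : ∀ (l : Filter ℝ) (L : Matrix (Fin n) (Fin n) ℝ), Tendsto (nu T) l (𝓝 0) →
      Tendsto A l (𝓝 L) → Tendsto (fun s => (1 - nu T s • A s)⁻¹) l (𝓝 1) := by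
    intro l L h1 h2
    refine hinv.comp ?_
    have h3 := (tendsto_const_nhds (x := (1 : Matrix (Fin n) (Fin n) ℝ))).sub (h1.smul h2)
    rwa [zero_smul, sub_zero] at h3
  intro s hs
  refine ⟨fun hr => ?_, 1, ?_⟩
  · have h0 : nu T s = 0 := by rw [nu, hr, sub_self]
    have h1 := key _ _ (tendsto_nu_of_tendsto hs le_rfl (Or.inl hr)) ((hA s hs).1 hr)
    rwa [ContinuousWithinAt, h0, zero_smul, sub_zero, inv_one]
  · obtain ⟨L, hL⟩ := (hA s hs).2
    refine key _ L (tendsto_nu_of_tendsto hs (nhdsWithin_mono s inter_subset_left) (Or.inr ?_)) hL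
    filter_upwards [self_mem_nhdsWithin] with t ht
    exact ht.2

theorem LdCont.matrix_mul {k l m : ℕ} {D : ℝ → Matrix (Fin k) (Fin l) ℝ}
    {F : ℝ → Matrix (Fin l) (Fin m) ℝ} (hD : LdCont T D) (hF : LdCont T F) :
    LdCont T fun s => D s * F s :=
  hD.comp₂ hF (continuous_fst.matrix_mul continuous_snd)

theorem LdCont.bounded_mulVec (hT : IsClosed T) (hne : T.Nonempty) (hA : LdCont T A) (a b : ℝ) :
    ∃ C, ∀ t ∈ Icc a b, ∀ v, ‖(A (ceilT T t)).mulVec v‖ ≤ C * ‖v‖ := by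
  choose C hC using fun i j => (hA.entry i j).bounded_comp_ceilT hT hne a b
  refine ⟨∑ i, ∑ j, |C i j|, fun t ht v => ?_⟩
  refine (pi_norm_le_iff_of_nonneg (by positivity)).2 fun i => ?_
  calc ‖(A (ceilT T t)).mulVec v i‖ ≤ ∑ j, ‖A (ceilT T t) i j * v j‖ := by
        rw [Matrix.mulVec, dotProduct]
        exact norm_sum_le _ _
    _ ≤ ∑ j, |C i j| * ‖v‖ := Finset.sum_le_sum fun j _ => by
        rw [norm_mul]
        exact mul_le_mul ((hC i j t ht).trans (le_abs_self _)) (norm_le_pi_norm v j)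
          (norm_nonneg _) (abs_nonneg _)
    _ = (∑ j, |C i j|) * ‖v‖ := by rw [Finset.sum_mul]
    _ ≤ _ := by
        refine mul_le_mul_of_nonneg_right ?_ (norm_nonneg v)
        exact Finset.single_le_sum (f := fun i => ∑ j, |C i j|) (fun i _ => by positivity)
          (Finset.mem_univ i)

theorem LdCont.measurable_mulVec (hT : IsClosed T) (hne : T.Nonempty) (hA : LdCont T A)
    {u : ℝ → Fin n → ℝ} (hu : Measurable u) :
    Measurable fun t => (A (ceilT T t)).mulVec (u t) := by
  refine measurable_pi_iff.2 fun i => ?_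
  simp only [Matrix.mulVec, dotProduct]
  refine Finset.measurable_sum _ fun j _ => ?_
  exact ((hA.entry i j).stronglyMeasurable_comp_ceilT hT hne).measurable.mul
    (measurable_pi_iff.1 hu j)

/-- The initial value problem `y^∇ = A y`, `y(z) = x₀` for a progressive `A` has a solution below
and above `z`. Below `z` the solution satisfies the integral equation with integrand
`A(t) y(t)`, above `z` the one with integrand `A(t) (I - ν(t) A(t))⁻¹ y(ρ(t))`; together, these
form a single Volterra equation in which the state is always evaluated between `z` and `t`. -/
theorem exists_solution (hT : IsClosed T) (hA : LdCont T A)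
    (hprog : ∀ s ∈ T, IsUnit (1 - nu T s • A s)) (hz : z ∈ T) (x₀ : Fin n → ℝ) :
    ∃ y : ℝ → Fin n → ℝ, y z = x₀ ∧
      ∀ s ∈ T, ∀ i, HasNablaDeriv T (fun t => y t i) ((A s).mulVec (y s) i) s := by
  classical
  have hne : T.Nonempty := ⟨z, hz⟩
  set M : ℝ → Matrix (Fin n) (Fin n) ℝ := fun s => A s * (1 - nu T s • A s)⁻¹ with hM
  have hMld : LdCont T M := hA.matrix_mul hA.resolvent
  set K₀ : ℝ → Matrix (Fin n) (Fin n) ℝ :=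
    fun t => if t ≤ z then A (ceilT T t) else M (ceilT T t) with hK₀
  set K : ℝ → (Fin n → ℝ) →L[ℝ] (Fin n → ℝ) :=
    fun t => LinearMap.toContinuousLinearMap (K₀ t).mulVecLin with hK
  have hKapp : ∀ t v, K t v = (K₀ t).mulVec v := fun t v => rfl
  set τ : ℝ → ℝ := fun t => if t ≤ z then ceilT T t else max z (rho T (ceilT T t)) with hτdef
  have hτ : ∀ t, |τ t - z| ≤ |t - z| := by
    intro t
    rcases le_or_gt t z with htz | htz
    · have h1 := le_ceilT hz htz
      have h2 := ceilT_le hz htz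
      rw [hτdef]
      simp only [if_pos htz]
      rw [abs_of_nonpos (by linarith), abs_of_nonpos (by linarith)]
      linarith
    · have h1 := rho_ceilT_le hT hz htz.le
      have h2 : max z (rho T (ceilT T t)) ≤ t := max_le htz.le h1
      have h3 := le_max_left z (rho T (ceilT T t))
      rw [hτdef]
      simp only [if_neg (not_le.2 htz)]
      rw [abs_of_nonneg (by linarith), abs_of_nonneg (by linarith)]
      linarith
  have hbd : ∀ R, ∃ C, ∀ t, |t - z| ≤ R → ∀ v, ‖K t v‖ ≤ C * ‖v‖ := by
    intro R
    obtain ⟨C, hC⟩ := hA.bounded_mulVec hT hne (z - R) (z + R)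
    obtain ⟨D, hD⟩ := hMld.bounded_mulVec hT hne (z - R) (z + R)
    refine ⟨max C D, fun t ht v => ?_⟩
    have ht' : t ∈ Icc (z - R) (z + R) := by
      rw [abs_le] at ht
      constructor <;> linarith [ht.1, ht.2]
    rw [hKapp, hK₀]
    by_cases htz : t ≤ z
    · simp only [if_pos htz]
      exact (hC t ht' v).trans (mul_le_mul_of_nonneg_right (le_max_left _ _) (norm_nonneg v))
    · simp only [if_neg htz]
      exact (hD t ht' v).trans (mul_le_mul_of_nonneg_right (le_max_right _ _) (norm_nonneg v))
  have hcm := ceilT_mono hT hne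
  have hρm : Monotone fun t => rho T (ceilT T t) := by
    intro t u htu
    rcases (hcm htu).eq_or_lt with h | h
    · exact (congrArg (rho T) h).le
    · exact rho_le.trans (le_rho (ceilT_mem hT hne t) h)
  have hτm : Measurable τ := Measurable.ite measurableSet_Iic hcm.measurable
    (measurable_const.max hρm.measurable)
  have hmeas : ∀ u : ℝ → Fin n → ℝ, Continuous u →
      AEStronglyMeasurable (fun t => K t (u (τ t))) volume := by
    intro u hu
    have huτ : Measurable fun t => u (τ t) := hu.measurable.comp hτm
    have h1 : Measurable fun t => if t ≤ z then (A (ceilT T t)).mulVec (u (τ t))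
        else (M (ceilT T t)).mulVec (u (τ t)) :=
      Measurable.ite measurableSet_Iic (hA.measurable_mulVec hT hne huτ)
        (hMld.measurable_mulVec hT hne huτ)
    refine h1.aestronglyMeasurable.congr (Eventually.of_forall fun t => ?_)
    by_cases htz : t ≤ z <;> simp [hKapp, hK₀, htz]
  obtain ⟨y, hyc, hy⟩ := exists_volterra hτ hbd hmeas x₀
  have hyint := intervalIntegrable_volterra hτ hbd hmeas hyc
  have hstep : ∀ p ∈ T, z < p → y (rho T p) = (1 - nu T p • A p).mulVec (y p) := by
    intro p hp hzp
    have hzr := le_rho hz hzp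
    have h1 : y p - y (rho T p) = ∫ t in rho T p..p, K t (y (τ t)) := by
      rw [hy p, hy (rho T p), add_sub_add_left_eq_sub]
      exact intervalIntegral.integral_interval_sub_left (hyint _ _) (hyint _ _)
    have h2 : ∫ t in rho T p..p, K t (y (τ t)) =
        ∫ t in rho T p..p, (M p).mulVec (y (rho T p)) := by
      refine intervalIntegral.integral_congr_ae (Eventually.of_forall fun t ht => ?_)
      rw [uIoc_of_le rho_le] at ht
      have htz : ¬ t ≤ z := not_le.2 (hzr.trans_lt ht.1)
      simp only [hKapp, hK₀, hτdef, if_neg htz, ceilT_eq hT hp ht.1 ht.2, max_eq_right hzr]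
    rw [h2, intervalIntegral.integral_const, ← nu, ← Matrix.smul_mulVec] at h1
    have h3 : y p = (1 + nu T p • M p).mulVec (y (rho T p)) := by
      rw [Matrix.add_mulVec, Matrix.one_mulVec, ← h1]
      abel
    have hU := (Matrix.isUnit_iff_isUnit_det _).1 (hprog p hp)
    have h4 : 1 + nu T p • M p = (1 - nu T p • A p)⁻¹ := by
      calc 1 + nu T p • M p = ((1 - nu T p • A p) + nu T p • A p) * (1 - nu T p • A p)⁻¹ := by
            rw [add_mul, Matrix.mul_nonsing_inv _ hU, hM, Matrix.smul_mul]
        _ = _ := by rw [sub_add_cancel, one_mul]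
    rw [h3, h4, Matrix.mulVec_mulVec, Matrix.mul_nonsing_inv _ hU, Matrix.one_mulVec]
  have hKA : ∀ s ∈ T, ∀ t ∈ uIoc z s,
      K t (y (τ t)) = (A (ceilT T t)).mulVec (y (ceilT T t)) := by
    intro s hs t ht
    by_cases htz : t ≤ z
    · simp only [hKapp, hK₀, hτdef, if_pos htz]
    · have hzt := not_le.1 htz
      have hp := ceilT_mem hT hne t
      have hts : t ≤ s := by
        rcases mem_uIoc.1 ht with h | h
        · exact h.2
        · exact absurd h.2 htz
      have hzp : z < ceilT T t := hzt.trans_le (le_ceilT hs hts)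
      have hU := (Matrix.isUnit_iff_isUnit_det _).1 (hprog _ hp)
      simp only [hKapp, hK₀, hτdef, if_neg htz, max_eq_right (le_rho hz hzp)]
      rw [hstep _ hp hzp, Matrix.mulVec_mulVec, hM, Matrix.mul_assoc,
        Matrix.nonsing_inv_mul _ hU, Matrix.mul_one]
  refine ⟨y, by rw [hy z, intervalIntegral.integral_same, add_zero], fun s hs i => ?_⟩
  have hAy : LdCont T fun t => (A t).mulVec (y t) :=
    hA.comp₂ (ldCont_of_continuousOn hyc.continuousOn) (continuous_fst.matrix_mulVec continuous_snd)
  have hld : LdCont T fun t => (A t).mulVec (y t) i := hAy.comp_continuous (continuous_apply i)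
  have heq : ∀ u ∈ T, y u i = x₀ i + ∫ t in z..u, (A (ceilT T t)).mulVec (y (ceilT T t)) i := by
    intro u hu
    have h1 := ContinuousLinearMap.intervalIntegral_comp_comm
      (ContinuousLinearMap.proj (R := ℝ) (φ := fun _ : Fin n => ℝ) i) (hyint z u)
    have h2 : y u i = x₀ i + (∫ t in z..u, K t (y (τ t))) i := by
      conv_lhs => rw [hy u]
      rfl
    rw [h2]
    congr 1
    refine h1.symm.trans (intervalIntegral.integral_congr_ae (Eventually.of_forall fun t ht => ?_))
    simp only [ContinuousLinearMap.proj_apply, hKA u hu t ht]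
  have hd := (hasNablaDeriv_const (T := T) (s := s) (x₀ i)).add hs
    (hld.hasNablaDeriv_integral hT z hs)
  rw [zero_add] at hd
  intro ε hε
  filter_upwards [hd ε hε, self_mem_nhdsWithin] with t ht htT
  simp only [heq t htT, heq _ (rho_mem hT hs)]
  exact ht

end Linear

section FundamentalPair

variable {n k l : ℕ} {A : ℝ → Matrix (Fin n) (Fin n) ℝ}

theorem HasNablaDeriv.matrix_mul {F : ℝ → Matrix (Fin k) (Fin n) ℝ}
    {H : ℝ → Matrix (Fin n) (Fin l) ℝ} {D : Matrix (Fin k) (Fin n) ℝ}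
    {E : Matrix (Fin n) (Fin l) ℝ} (hs : s ∈ T)
    (hF : ∀ i j, HasNablaDeriv T (fun t => F t i j) (D i j) s)
    (hH : ∀ i j, HasNablaDeriv T (fun t => H t i j) (E i j) s) (i : Fin k) (j : Fin l) :
    HasNablaDeriv T (fun t => (F t * H t) i j) ((D * H s + F (rho T s) * E) i j) s := by
  have h := HasNablaDeriv.sum Finset.univ hs fun a _ => (hF i a).mul hs (hH a j)
  simpa only [Matrix.add_apply, Matrix.mul_apply, Finset.sum_add_distrib] using h

theorem HasNablaDeriv.mulVec {F : ℝ → Matrix (Fin k) (Fin n) ℝ} {y : ℝ → Fin n → ℝ}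
    {D : Matrix (Fin k) (Fin n) ℝ} {e : Fin n → ℝ} (hs : s ∈ T)
    (hF : ∀ i j, HasNablaDeriv T (fun t => F t i j) (D i j) s)
    (hy : ∀ i, HasNablaDeriv T (fun t => y t i) (e i) s) (i : Fin k) :
    HasNablaDeriv T (fun t => (F t).mulVec (y t) i)
      ((D.mulVec (y s) + (F (rho T s)).mulVec e) i) s := by
  have h := HasNablaDeriv.sum Finset.univ hs fun a _ => (hF i a).mul hs (hy a)
  simpa only [Pi.add_apply, Matrix.mulVec, dotProduct, Finset.sum_add_distrib] using h

theorem HasNablaDeriv.const_dotProduct {y : ℝ → Fin n → ℝ} {e : Fin n → ℝ} (hs : s ∈ T)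
    (w : Fin n → ℝ) (hy : ∀ i, HasNablaDeriv T (fun t => y t i) (e i) s) :
    HasNablaDeriv T (fun t => w ⬝ᵥ y t) (w ⬝ᵥ e) s := by
  have h := HasNablaDeriv.sum Finset.univ hs fun i _ => (hasNablaDeriv_const (w i)).mul hs (hy i)
  simp only [zero_mul, zero_add] at h
  exact h

/-- The product of a solution of the adjoint equation and a solution of `Y^∇ = A Y` is constant. -/
theorem mul_eq_mul_of_adjoint (hT : IsClosed T) {X : ℝ → Matrix (Fin k) (Fin n) ℝ}
    {Y : ℝ → Matrix (Fin n) (Fin l) ℝ}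
    (hX : ∀ s ∈ kappa T, ∀ i j,
      HasNablaDeriv T (fun t => X t i j) ((-(X (rho T s) * A s)) i j) s)
    (hY : ∀ s ∈ kappa T, ∀ i j, HasNablaDeriv T (fun t => Y t i j) ((A s * Y s) i j) s)
    (hs : s ∈ T) (hz : z ∈ T) : X s * Y s = X z * Y z := by
  ext i j
  refine eq_of_hasNablaDeriv_zero_kappa hT (f := fun t => (X t * Y t) i j) (fun u hu => ?_) hs hz
  have h1 := HasNablaDeriv.matrix_mul (kappa_subset hu) (hX u hu) (hY u hu) i j
  have h2 : -(X (rho T u) * A u) * Y u + X (rho T u) * (A u * Y u) = 0 := by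
    rw [Matrix.neg_mul, Matrix.mul_assoc, neg_add_cancel]
  rwa [h2] at h1

/-- A fundamental matrix `Φ` of `y^∇ = A y` together with its inverse `X`, which solves the adjoint
equation `X^∇(s) = -X(ρ(s)) A(s)`. -/
structure IsFundamentalPair (T : Set ℝ) (A Φ X : ℝ → Matrix (Fin n) (Fin n) ℝ) : Prop where
  inv_mul : ∀ s ∈ T, X s * Φ s = 1
  deriv : ∀ s ∈ kappa T, ∀ i j, HasNablaDeriv T (fun t => Φ t i j) ((A s * Φ s) i j) s
  deriv_inv : ∀ s ∈ kappa T, ∀ i j,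
    HasNablaDeriv T (fun t => X t i j) ((-(X (rho T s) * A s)) i j) s

namespace IsFundamentalPair

variable {Φ X : ℝ → Matrix (Fin n) (Fin n) ℝ}

theorem mul_inv (h : IsFundamentalPair T A Φ X) (hs : s ∈ T) : Φ s * X s = 1 :=
  mul_eq_one_comm.1 (h.inv_mul s hs)

theorem continuousOn (h : IsFundamentalPair T A Φ X) : ContinuousOn Φ T := fun s hs =>
  tendsto_pi_nhds.2 fun i => tendsto_pi_nhds.2 fun j =>
    continuousOn_of_hasNablaDeriv (fun s hs => h.deriv s hs i j) s hs

theorem continuousOn_inv (h : IsFundamentalPair T A Φ X) : ContinuousOn X T := fun s hs =>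
  tendsto_pi_nhds.2 fun i => tendsto_pi_nhds.2 fun j =>
    continuousOn_of_hasNablaDeriv (fun s hs => h.deriv_inv s hs i j) s hs

theorem isTransition (h : IsFundamentalPair T A Φ X) :
    IsTransition T A fun s z => Φ s * X z := by
  refine fun z hz => ⟨h.mul_inv hz, fun s hs i j => ?_⟩
  have h1 := HasNablaDeriv.matrix_mul (kappa_subset hs) (h.deriv s hs)
    (H := fun _ => X z) (E := 0) (fun i j => hasNablaDeriv_const (X z i j)) i j
  rwa [Matrix.mul_zero, add_zero, Matrix.mul_assoc] at h1

theorem transition_eq (hT : IsClosed T) (h : IsFundamentalPair T A Φ X) (hs : s ∈ T)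
    (hz : z ∈ T) : transition T A s z = Φ s * X z := by
  have hex : ∃ Ψ, IsTransition T A Ψ := ⟨_, h.isTransition⟩
  rw [transition, dif_pos hex]
  obtain ⟨h1, h2⟩ := hex.choose_spec z hz
  have h3 := mul_eq_mul_of_adjoint hT h.deriv_inv h2 hs hz
  rw [h1, Matrix.mul_one] at h3
  rw [← h3, ← Matrix.mul_assoc, h.mul_inv hs, Matrix.one_mul]

end IsFundamentalPair

theorem isFundamentalPair_one : IsFundamentalPair T (fun _ => (0 : Matrix (Fin n) (Fin n) ℝ))
    (fun _ => 1) (fun _ => 1) := by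
  refine ⟨fun _ _ => mul_one 1, fun s _ i j => ?_, fun s _ i j => ?_⟩
  · rw [Matrix.zero_mul]
    exact hasNablaDeriv_const _
  · rw [Matrix.mul_zero, neg_zero]
    exact hasNablaDeriv_const _

/-- A progressive equation has a fundamental matrix. Its inverse is obtained as a solution of the
progressive equation `X^∇ = -X (I - ν A)⁻¹ A`, which is equivalent to the adjoint equation. -/
theorem exists_isFundamentalPair (hT : IsClosed T) (hne : T.Nonempty) (hA : LdCont T A)
    (hprog : ∀ s ∈ T, IsUnit (1 - nu T s • A s)) : ∃ Φ X, IsFundamentalPair T A Φ X := by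
  obtain ⟨z, hz⟩ := hne
  set A' : ℝ → Matrix (Fin n) (Fin n) ℝ := fun s => -((1 - nu T s • A s)⁻¹ * A s) with hA'
  have hA'1 : ∀ s ∈ T, 1 - nu T s • A' s = (1 - nu T s • A s)⁻¹ := by
    intro s hs
    have hU := (Matrix.isUnit_iff_isUnit_det _).1 (hprog s hs)
    calc 1 - nu T s • A' s = (1 - nu T s • A s)⁻¹ * ((1 - nu T s • A s) + nu T s • A s) := by
          rw [mul_add, Matrix.nonsing_inv_mul _ hU, hA', Matrix.mul_smul]
          simp only [smul_neg, sub_neg_eq_add]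
      _ = _ := by rw [sub_add_cancel, mul_one]
  have hA'ld : LdCont T fun s => (A' s).transpose :=
    (hA.resolvent.matrix_mul hA).comp_continuous continuous_neg.matrix_transpose
  have hA'prog : ∀ s ∈ T, IsUnit (1 - nu T s • (A' s).transpose) := by
    intro s hs
    have h1 : 1 - nu T s • (A' s).transpose = (1 - nu T s • A' s).transpose := by simp
    rw [h1, hA'1 s hs, Matrix.isUnit_transpose, Matrix.isUnit_nonsing_inv_iff]
    exact hprog s hs
  choose y hyz hy using fun j => exists_solution hT hA hprog hz (Pi.single j 1)
  choose x hxz hx using fun i => exists_solution hT hA'ld hA'prog hz (Pi.single i 1)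
  set Φ : ℝ → Matrix (Fin n) (Fin n) ℝ := fun s => Matrix.of fun i j => y j s i with hΦ
  set X : ℝ → Matrix (Fin n) (Fin n) ℝ := fun s => Matrix.of fun i j => x i s j with hX
  have hΦz : Φ z = 1 := by
    ext i j
    simp [hΦ, hyz, Matrix.one_apply, Pi.single_apply]
  have hXz : X z = 1 := by
    ext i j
    simp [hX, hxz, Matrix.one_apply, Pi.single_apply, eq_comm]
  have hdΦ : ∀ s ∈ T, ∀ i j, HasNablaDeriv T (fun t => Φ t i j) ((A s * Φ s) i j) s :=
    fun s hs i j => hy j s hs i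
  have hdX : ∀ s ∈ T, ∀ i j, HasNablaDeriv T (fun t => X t i j) ((X s * A' s) i j) s := by
    intro s hs i j
    have h1 := hx i s hs j
    have h2 : (A' s).transpose.mulVec (x i s) j = (X s * A' s) i j := by
      rw [Matrix.mulVec_transpose]
      rfl
    rwa [h2] at h1
  have hXρ : ∀ s ∈ T, X s * A' s = -(X (rho T s) * A s) := by
    intro s hs
    have h1 : X s - X (rho T s) = nu T s • (X s * A' s) := by
      ext i j
      have := (hdX s hs i j).sub_rho hs
      rw [Matrix.sub_apply, Matrix.smul_apply, smul_eq_mul, this, mul_comm]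
    have h2 : X (rho T s) = X s * (1 - nu T s • A s)⁻¹ := by
      rw [← hA'1 s hs, mul_sub, mul_one, Matrix.mul_smul, ← h1, sub_sub_cancel]
    rw [h2, hA', Matrix.mul_neg, Matrix.mul_assoc]
  have hdX' : ∀ s ∈ T, ∀ i j,
      HasNablaDeriv T (fun t => X t i j) ((-(X (rho T s) * A s)) i j) s := fun s hs i j => by
    rw [← hXρ s hs]
    exact hdX s hs i j
  refine ⟨Φ, X, fun s hs => ?_, fun s hs => hdΦ s hs.1, fun s hs => hdX' s hs.1⟩
  rw [mul_eq_mul_of_adjoint hT (fun s hs => hdX' s hs.1) (fun s hs => hdΦ s hs.1) hs hz, hXz, hΦz,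
    mul_one]

end FundamentalPair

variable {n m p : ℕ}

/-! ### Auxiliary facts on limits and linear algebra -/

/-- The nabla derivative of a constant function is zero at each point with a predecessor. -/
theorem HasNablaDeriv.eq_zero_of_const (hT : IsClosed T) {f : ℝ → ℝ} {d c : ℝ}
    (h : HasNablaDeriv T f d s)
    (hs : s ∈ T) (ht : t ∈ T) (hts : t < s) (hf : ∀ u ∈ T, f u = c) : d = 0 := by
  rcases (rho_le (T := T) (s := s)).eq_or_lt with hr | hr
  · have hne : (T ∩ Iio s).Nonempty := ⟨t, ht, hts⟩
    have hcl : s ∈ closure (T ∩ Iio s) := by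
      have h1 := csSup_mem_closure hne ⟨s, fun u hu => le_of_lt hu.2⟩
      rw [rho, if_pos hne] at hr
      rwa [hr] at h1
    have := mem_closure_iff_nhdsWithin_neBot.1 hcl
    refine abs_nonpos_iff.1 (le_of_forall_pos_le_add fun ε hε => ?_)
    obtain ⟨u, hu, huT⟩ := (((h ε hε).filter_mono (nhdsWithin_mono s inter_subset_left)).and
      self_mem_nhdsWithin : ∀ᶠ u in 𝓝[T ∩ Iio s] s, _ ∧ u ∈ T ∩ Iio s).exists
    have hsu : 0 < |s - u| := abs_pos.2 (sub_ne_zero.2 (ne_of_gt huT.2))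
    rw [hr, hf s hs, hf u huT.1, sub_self, zero_sub, abs_neg, abs_mul] at hu
    rw [zero_add]
    exact le_of_mul_le_mul_right hu hsu
  · have h2 := h.sub_rho hs
    rw [hf s hs, hf _ (rho_mem hT hs), sub_self] at h2
    exact (mul_eq_zero.1 h2.symm).resolve_right (sub_pos.2 hr).ne'

/-- A matrix function that is ld-continuous and annihilates `w` at all points of `T` with a
predecessor annihilates `w` on `kappa T`, because a minimum of `T` in `kappa T` is right-dense. -/
theorem LdCont.mulVec_eq_zero {q : ℕ} (hT2 : T.Nontrivial) {D : ℝ → Matrix (Fin q) (Fin n) ℝ}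
    (hD : LdCont T D) {w : Fin n → ℝ}
    (h : ∀ t ∈ T, ∀ s ∈ T, t < s → (D s).mulVec w = 0) (hs : s ∈ kappa T) :
    (D s).mulVec w = 0 := by
  by_cases hmin : ∃ t ∈ T, t < s
  · obtain ⟨t, ht, hts⟩ := hmin
    exact h t ht s hs.1 hts
  · push Not at hmin
    have hσ : sigma T s = s :=
      le_antisymm (not_lt.1 fun hlt => hs.2 ⟨⟨hs.1, hmin⟩, hlt⟩) le_sigma
    have hρ : rho T s = s := by
      have hempty : ¬ (T ∩ Iio s).Nonempty := fun ⟨t, ht, hts⟩ => absurd (hmin t ht) (not_le.2 hts)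
      rw [rho, if_neg hempty]
    have hne : (T ∩ Ioi s).Nonempty := by
      obtain ⟨t, ht, hts⟩ := hT2.exists_ne s
      exact ⟨t, ht, lt_of_le_of_ne (hmin t ht) hts.symm⟩
    have hcl : s ∈ closure (T ∩ Ioi s) := by
      have h1 := csInf_mem_closure hne ⟨s, fun u hu => le_of_lt hu.2⟩
      rw [sigma, if_pos hne] at hσ
      rwa [hσ] at h1
    have := mem_closure_iff_nhdsWithin_neBot.1 hcl
    have hcont : Continuous fun M : Matrix (Fin q) (Fin n) ℝ => M.mulVec w :=
      continuous_id.matrix_mulVec continuous_const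
    have h1 : Tendsto (fun t => (D t).mulVec w) (𝓝[T ∩ Ioi s] s) (𝓝 ((D s).mulVec w)) :=
      (hcont.tendsto _).comp
        (((hD s hs.1).1 hρ).tendsto.mono_left (nhdsWithin_mono s inter_subset_left))
    refine tendsto_nhds_unique h1 (tendsto_const_nhds.congr' ?_)
    filter_upwards [self_mem_nhdsWithin] with t ht
    exact (h s hs.1 t ht.1 ht.2).symm

/-- If only `w = 0` is annihilated by `D(z)` for all `z` with a predecessor, then this holds with
`z` restricted to some `(a, b] ∩ T`, by the descending chain condition for the annihilated
subspaces. -/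
theorem exists_Ioc_injective {q : ℕ} (hT2 : T.Nontrivial) {D : ℝ → Matrix (Fin q) (Fin n) ℝ}
    (h : ∀ w, (∀ t ∈ T, ∀ s ∈ T, t < s → (D s).mulVec w = 0) → w = 0) :
    ∃ a ∈ T, ∃ b ∈ T, a < b ∧ ∀ w, (∀ s ∈ T ∩ Ioc a b, (D s).mulVec w = 0) → w = 0 := by
  let N : ℝ × ℝ → Submodule ℝ (Fin n → ℝ) := fun q =>
    ⨅ s ∈ T ∩ Ioc q.1 q.2, LinearMap.ker (D s).mulVecLin
  have hN : ∀ q w, w ∈ N q ↔ ∀ s ∈ T ∩ Ioc q.1 q.2, (D s).mulVec w = 0 := by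
    intro q w
    simp only [N, Submodule.mem_iInf, LinearMap.mem_ker, Matrix.mulVecLin_apply]
  let J : Set (ℝ × ℝ) := {q | q.1 ∈ T ∧ q.2 ∈ T ∧ q.1 < q.2}
  have hJ : J.Nonempty := by
    obtain ⟨a, ha, b, hb, hab⟩ := hT2.exists_lt
    exact ⟨(a, b), ha, hb, hab⟩
  obtain ⟨_, ⟨⟨a, b⟩, ⟨ha, hb, hab⟩, rfl⟩, hmin⟩ :=
    (wellFounded_lt (α := Submodule ℝ (Fin n → ℝ))).has_min (N '' J) (hJ.image N)
  refine ⟨a, ha, b, hb, hab, fun w hw => h w fun t ht s hs hts => ?_⟩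
  have hm : (min a t, max b s) ∈ J := by
    refine ⟨?_, ?_, (min_le_left _ _).trans_lt (hab.trans_le (le_max_left _ _))⟩
    · rcases min_choice a t with h | h <;> simp only [h, ha, ht]
    · rcases max_choice b s with h | h <;> simp only [h, hb, hs]
  have hle : N (min a t, max b s) ≤ N (a, b) := fun x hx => (hN _ _).2 fun u hu =>
    (hN _ _).1 hx u ⟨hu.1, (min_le_left _ _).trans_lt hu.2.1, hu.2.2.trans (le_max_left _ _)⟩
  have heq : N (min a t, max b s) = N (a, b) :=
    hle.eq_of_not_lt (hmin _ (mem_image_of_mem N hm))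
  have hw' : w ∈ N (min a t, max b s) := heq ▸ (hN _ _).2 hw
  exact (hN _ _).1 hw' s ⟨hs, (min_le_right _ _).trans_lt hts, le_max_right _ _⟩

/-- The matrices that annihilate a given nonzero vector factor through dimension `n - 1`. -/
theorem exists_factor_of_mulVec_eq_zero {w : Fin n → ℝ} (hw : w ≠ 0) :
    ∃ k < n, ∃ (P : Matrix (Fin n) (Fin k) ℝ) (Q : Matrix (Fin k) (Fin n) ℝ),
      ∀ (q : ℕ) (D : Matrix (Fin q) (Fin n) ℝ), D.mulVec w = 0 → D * (P * Q) = D := by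
  set W := Submodule.span ℝ {w}
  have hk : Module.finrank ℝ ((Fin n → ℝ) ⧸ W) < n := by
    have h1 := Submodule.finrank_quotient_add_finrank W
    have h2 : Module.finrank ℝ W = 1 := finrank_span_singleton hw
    rw [h2, Module.finrank_fin_fun] at h1
    omega
  let e : ((Fin n → ℝ) ⧸ W) ≃ₗ[ℝ] (Fin (Module.finrank ℝ ((Fin n → ℝ) ⧸ W)) → ℝ) :=
    LinearEquiv.ofFinrankEq _ _ (by rw [Module.finrank_fin_fun])
  let f := e.toLinearMap ∘ₗ W.mkQ
  have hf : Function.Surjective f := e.surjective.comp W.mkQ_surjective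
  obtain ⟨g, hg⟩ := LinearMap.exists_rightInverse_of_surjective f (LinearMap.range_eq_top.2 hf)
  refine ⟨_, hk, LinearMap.toMatrix' g, LinearMap.toMatrix' f, fun q D hD => ?_⟩
  refine Matrix.toLin'.injective (LinearMap.ext fun x => ?_)
  rw [← LinearMap.toMatrix'_comp, Matrix.toLin'_mul, Matrix.toLin'_toMatrix']
  have h1 : f (g (f x) - x) = 0 := by
    rw [map_sub, ← LinearMap.comp_apply, hg, LinearMap.id_apply, sub_self]
  have h2 : g (f x) - x ∈ W := by
    rw [← Submodule.Quotient.mk_eq_zero]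
    exact e.map_eq_zero_iff.1 h1
  obtain ⟨c, hc⟩ := Submodule.mem_span_singleton.1 h2
  have h3 : Matrix.toLin' D (g (f x) - x) = 0 := by
    rw [← hc, map_smul, Matrix.toLin'_apply, hD, smul_zero]
  rw [map_sub, sub_eq_zero] at h3
  exact h3

/-- If `L(s) R(z) = L'(s) R'(z)`, where the `L(s)` have no common kernel and the `R(z)` have jointly
full range, then the inner dimension of the first factorization is at most that of the second. -/
theorem le_of_factorization {n' : ℕ} {J : Set ℝ} {L : ℝ → Matrix (Fin p) (Fin n) ℝ}
    {R : ℝ → Matrix (Fin n) (Fin m) ℝ} {L' : ℝ → Matrix (Fin p) (Fin n') ℝ}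
    {R' : ℝ → Matrix (Fin n') (Fin m) ℝ} (h : ∀ s ∈ J, ∀ z ∈ J, L s * R z = L' s * R' z)
    (hL : ∀ x, (∀ s ∈ J, (L s).mulVec x = 0) → x = 0)
    (hR : ∀ w, (∀ z ∈ J, (R z).transpose.mulVec w = 0) → w = 0) : n ≤ n' := by
  let Θ := Finsupp.linearCombination ℝ fun q : J × Fin m => (R q.1).col q.2
  let Θ' := Finsupp.linearCombination ℝ fun q : J × Fin m => (R' q.1).col q.2
  have hcomp : ∀ s ∈ J, ∀ c, (L s).mulVec (Θ c) = (L' s).mulVec (Θ' c) := by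
    intro s hs c
    have h1 : (L s).mulVecLin ∘ₗ Θ = (L' s).mulVecLin ∘ₗ Θ' := by
      refine Finsupp.lhom_ext fun q b => ?_
      have h2 := h s hs q.1 q.1.2
      simp only [Θ, Θ', LinearMap.comp_apply, Finsupp.linearCombination_single, map_smul,
        Matrix.mulVecLin_apply]
      congr 1
      ext i
      exact congrFun (congrFun h2 i) q.2
    exact LinearMap.congr_fun h1 c
  have hsurj : LinearMap.range Θ = ⊤ := by
    by_contra hne
    obtain ⟨f, hf, hle⟩ := Submodule.exists_le_ker_of_lt_top _ (lt_top_iff_ne_top.2 hne)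
    have hfw : ∀ x, f x = x ⬝ᵥ fun i => f (Pi.single i 1) := by
      intro x
      conv_lhs => rw [pi_eq_sum_univ' x, map_sum]
      refine Finset.sum_congr rfl fun i _ => ?_
      rw [map_smul, smul_eq_mul]
    refine hf (LinearMap.ext fun x => ?_)
    have hw : (fun i => f (Pi.single i 1)) = 0 := hR _ fun z hz => by
      ext j
      have h1 : f ((R z).col j) = 0 := hle ⟨Finsupp.single (⟨z, hz⟩, j) 1, by simp [Θ]⟩
      rw [hfw] at h1
      exact h1
    rw [hfw, hw, dotProduct_zero, LinearMap.zero_apply]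
  obtain ⟨g, hg⟩ := LinearMap.exists_rightInverse_of_surjective Θ hsurj
  have hinj : Function.Injective (Θ' ∘ₗ g) := by
    refine (injective_iff_map_eq_zero _).2 fun x hx => hL x fun s hs => ?_
    have h1 := hcomp s hs (g x)
    rw [← LinearMap.comp_apply, hg, LinearMap.id_apply] at h1
    rw [h1]
    rw [LinearMap.comp_apply] at hx
    rw [hx, Matrix.mulVec_zero]
  simpa using LinearMap.finrank_le_finrank_of_injective hinj

/-! ### Factorization of the weighting pattern -/

namespace BackwardSystem

variable {S : BackwardSystem T n m p} {Φ X : ℝ → Matrix (Fin n) (Fin n) ℝ}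

theorem ldCont_A (S : BackwardSystem T n m p) : LdCont T S.A :=
  ldCont_matrix fun i j => ldContinuous_iff_ldCont.1 (S.ldA i j)

theorem ldCont_B (S : BackwardSystem T n m p) : LdCont T S.B :=
  ldCont_matrix fun i j => ldContinuous_iff_ldCont.1 (S.ldB i j)

theorem ldCont_C (S : BackwardSystem T n m p) : LdCont T S.C :=
  ldCont_matrix fun i j => ldContinuous_iff_ldCont.1 (S.ldC i j)

theorem Progressive.exists_isFundamentalPair (hS : S.Progressive) (hT : IsClosed T)
    (hne : T.Nonempty) : ∃ Φ X, IsFundamentalPair T S.A Φ X := by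
  refine NablaControl.exists_isFundamentalPair hT hne S.ldCont_A fun s hs => ?_
  by_cases hk : s ∈ kappa T
  · exact hS s hk
  · have hmin : ¬ (T ∩ Iio s).Nonempty := fun ⟨t, ht, hts⟩ => hk (mem_kappa_of_lt ht hs hts)
    rw [nu, rho, if_neg hmin, sub_self, zero_smul, sub_zero]
    exact isUnit_one

/-- The output factor `C(s) Φ(s)` of the weighting pattern. -/
def outputFactor (S : BackwardSystem T n m p) (Φ : ℝ → Matrix (Fin n) (Fin n) ℝ) (s : ℝ) :
    Matrix (Fin p) (Fin n) ℝ :=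
  S.C s * Φ s

/-- The input factor `Φ(ρ(z))⁻¹ B(z)` of the weighting pattern, where `X` stands for `Φ⁻¹`. -/
noncomputable def inputFactor (S : BackwardSystem T n m p) (X : ℝ → Matrix (Fin n) (Fin n) ℝ)
    (z : ℝ) : Matrix (Fin n) (Fin m) ℝ :=
  X (rho T z) * S.B z

theorem weightingPattern_eq (hT : IsClosed T) (h : IsFundamentalPair T S.A Φ X) (hs : s ∈ T)
    (hz : z ∈ T) : S.weightingPattern s z = S.outputFactor Φ s * S.inputFactor X z := by
  rw [weightingPattern, h.transition_eq hT hs (rho_mem hT hz), outputFactor, inputFactor]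
  simp only [Matrix.mul_assoc]

theorem ldCont_outputFactor (S : BackwardSystem T n m p) (h : ContinuousOn Φ T) :
    LdCont T (S.outputFactor Φ) :=
  S.ldCont_C.matrix_mul (ldCont_of_continuousOn h)

theorem ldCont_inputFactor (hT : IsClosed T) (S : BackwardSystem T n m p) (h : ContinuousOn X T) :
    LdCont T (S.inputFactor X) :=
  (ldCont_comp_rho_of_continuousOn hT h).matrix_mul S.ldCont_B

/-- If the weighting pattern factors through dimension `k`, then it is realized by a system of
dimension `k`, namely by one with vanishing `A`. -/
theorem exists_realization_of_factor (hT : IsClosed T) {G : ℝ → ℝ → Matrix (Fin p) (Fin m) ℝ}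
    (hG : S.Realizes G) (h : IsFundamentalPair T S.A Φ X) {k : ℕ} (P : Matrix (Fin n) (Fin k) ℝ)
    (Q : Matrix (Fin k) (Fin n) ℝ)
    (hPQ : ∀ s ∈ kappa T, ∀ z ∈ kappa T, S.outputFactor Φ s * P * (Q * S.inputFactor X z) =
      S.outputFactor Φ s * S.inputFactor X z) :
    ∃ S' : BackwardSystem T k m p, S'.Progressive ∧ S'.Realizes G := by
  let S' : BackwardSystem T k m p :=
    { A := fun _ => 0
      B := fun z => Q * S.inputFactor X z
      C := fun s => S.outputFactor Φ s * P
      ldA := fun i j => ldContinuous_iff_ldCont.2 (ldCont_const _)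
      ldB := fun i j => ldContinuous_iff_ldCont.2
        (((ldCont_const Q).matrix_mul (S.ldCont_inputFactor hT h.continuousOn_inv)).entry i j)
      ldC := fun i j => ldContinuous_iff_ldCont.2
        (((S.ldCont_outputFactor h.continuousOn).matrix_mul (ldCont_const P)).entry i j) }
  refine ⟨S', fun s _ => ?_, fun s hs z hz => ?_⟩
  · rw [show S'.A s = 0 from rfl, smul_zero, sub_zero]
    exact isUnit_one
  · have h' : IsFundamentalPair T S'.A (fun _ => 1) (fun _ => 1) := isFundamentalPair_one
    rw [hG s hs z hz, weightingPattern_eq hT h hs.1 hz.1, ← hPQ s hs z hz,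
      weightingPattern_eq hT h' hs.1 hz.1]
    simp only [S', outputFactor, inputFactor, Matrix.mul_one, Matrix.one_mul]

/-! ### Controllability and observability in terms of the factors -/

/-- In the coordinates `Φ⁻¹ y`, the state equation of a solution is `(Φ⁻¹ y)^∇ = R v`, where `R` is
the input factor. -/
theorem hasNablaDeriv_inv_mulVec (h : IsFundamentalPair T S.A Φ X) (hs₁ : s₁ ∈ T)
    (hs : s ∈ T ∩ Ioc s₁ s₀) {u : Fin m → ℝ} {y : ℝ → Fin n → ℝ}
    (hy : ∀ i, HasNablaDeriv (T ∩ Icc s₁ s₀) (fun t => y t i)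
      (((S.A s).mulVec (y s) + (S.B s).mulVec u) i) s) (i : Fin n) :
    HasNablaDeriv (T ∩ Icc s₁ s₀) (fun t => (X t).mulVec (y t) i)
      ((S.inputFactor X s).mulVec u i) s := by
  have hX := fun i j => (h.deriv_inv s (mem_kappa_of_lt hs₁ hs.1 hs.2.1) i j).inter_Icc hs₁
    hs.2.1 hs.2.2
  have h1 := HasNablaDeriv.mulVec (T := T ∩ Icc s₁ s₀) ⟨hs.1, hs.2.1.le, hs.2.2⟩ hX hy i
  rw [rho_inter_Icc hs₁ hs.2.1 hs.2.2] at h1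
  convert h1 using 2
  rw [Matrix.mulVec_add, Matrix.mulVec_mulVec, Matrix.mulVec_mulVec, Matrix.neg_mulVec,
    neg_add_cancel_left, inputFactor]

theorem continuousOn_mulVec_apply {U : Set ℝ} {F : ℝ → Matrix (Fin p) (Fin n) ℝ}
    {y : ℝ → Fin n → ℝ} (hF : ContinuousOn F U) (hy : ContinuousOn y U) :
    ContinuousOn (fun t => (F t).mulVec (y t)) U := fun s hs =>
  ((continuous_fst.matrix_mulVec continuous_snd).tendsto (F s, y s)).comp
    ((hF s hs).prodMk_nhds (hy s hs))

theorem ControllableOn.eq_zero_of_inputFactor (hT : IsClosed T) (hc : S.ControllableOn s₁ s₀)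
    (h : IsFundamentalPair T S.A Φ X) (hs₀ : s₀ ∈ T) (hs₁ : s₁ ∈ T) (hlt : s₁ < s₀)
    {w : Fin n → ℝ} (hw : ∀ z ∈ T ∩ Ioc s₁ s₀, (S.inputFactor X z).transpose.mulVec w = 0) :
    w = 0 := by
  obtain ⟨v, y, -, ⟨hyc, E, hE, hy⟩, hy₀, hy₁⟩ := hc ((Φ s₀).mulVec w) 0
  -- the component of `Φ⁻¹ y` in the direction of `w` cannot be influenced by the control
  have hconst := eq_of_hasNablaDeriv_zero_Icc hT (a := s₁) (f := fun t => w ⬝ᵥ (X t).mulVec (y t))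
    (s := s₁) hs₀ ?_ hE.countable (fun s hs hcase => ?_) ⟨hs₁, le_rfl, hlt.le⟩
  · have h2 : w ⬝ᵥ w = 0 := by
      simpa [hy₀, hy₁, Matrix.mulVec_mulVec, h.inv_mul s₀ hs₀] using hconst.symm
    exact dotProduct_self_eq_zero.1 h2
  · exact (continuous_const.dotProduct continuous_id).comp_continuousOn
      (continuousOn_mulVec_apply (h.continuousOn_inv.mono inter_subset_left) hyc)
  · have hsU : s ∈ T ∩ Icc s₁ s₀ := ⟨hs.1, hs.2.1.le, hs.2.2⟩
    have h1 := HasNablaDeriv.const_dotProduct hsU w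
      (hasNablaDeriv_inv_mulVec h hs₁ hs (hy s hs hcase))
    rwa [Matrix.dotProduct_mulVec, ← Matrix.mulVec_transpose, hw s hs, zero_dotProduct] at h1

theorem ObservableOn.eq_zero_of_outputFactor (ho : S.ObservableOn s₁ s₀)
    (h : IsFundamentalPair T S.A Φ X) (hs₀ : s₀ ∈ T) (hs₁ : s₁ ∈ T)
    {x : Fin n → ℝ} (hx : ∀ s ∈ T ∩ Ioc s₁ s₀, (S.outputFactor Φ s).mulVec x = 0) : x = 0 := by
  have hc : ContinuousOn (fun t => (Φ t).mulVec x) (T ∩ Icc s₁ s₀) :=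
    continuousOn_mulVec_apply (h.continuousOn.mono inter_subset_left) continuousOn_const
  have h1 := ho (fun _ => 0) (fun t => (Φ t).mulVec x) (fun _ => 0)
    (fun k => ⟨⟨∅, finite_empty, fun s _ _ _ => continuousWithinAt_const⟩,
      fun s _ => ⟨⟨0, tendsto_const_nhds⟩, 0, tendsto_const_nhds⟩⟩)
    ⟨hc, ∅, finite_empty, fun s hs _ i => ?_⟩
    ⟨continuousOn_const, ∅, finite_empty, fun s hs _ i => ?_⟩ (fun s hs => ?_)
  · have h2 := congrArg (X s₀).mulVec h1
    rwa [Matrix.mulVec_mulVec, h.inv_mul s₀ hs₀, Matrix.one_mulVec, Matrix.mulVec_zero] at h2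
  · have h2 := HasNablaDeriv.mulVec (y := fun _ => x) (e := 0) hs.1
      (h.deriv s (mem_kappa_of_lt hs₁ hs.1 hs.2.1)) (fun i => hasNablaDeriv_const (x i)) i
    rw [Matrix.mulVec_zero, add_zero, ← Matrix.mulVec_mulVec] at h2
    rw [Matrix.mulVec_zero, add_zero]
    exact h2.inter_Icc hs₁ hs.2.1 hs.2.2
  · simp only [Matrix.mulVec_zero, add_zero, Pi.zero_apply]
    exact hasNablaDeriv_const 0
  · rw [Matrix.mulVec_mulVec, Matrix.mulVec_zero]
    exact hx s hs

theorem observableOn_of_outputFactor (hT : IsClosed T) (h : IsFundamentalPair T S.A Φ X)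
    (hs₀ : s₀ ∈ T) (hs₁ : s₁ ∈ T)
    (hL : ∀ x, (∀ s ∈ T ∩ Ioc s₁ s₀, (S.outputFactor Φ s).mulVec x = 0) → x = 0) :
    S.ObservableOn s₁ s₀ := by
  rintro v y y' - ⟨hyc, E, hE, hy⟩ ⟨hyc', E', hE', hy'⟩ hout
  have hconst : ∀ s ∈ T ∩ Icc s₁ s₀,
      (X s).mulVec (y s - y' s) = (X s₀).mulVec (y s₀ - y' s₀) := by
    intro s hs
    ext i
    refine eq_of_hasNablaDeriv_zero_Icc hT (a := s₁) (f := fun t => (X t).mulVec (y t - y' t) i)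
      hs₀ ?_ (hE.union hE').countable (fun u hu hcase => ?_) hs
    · exact (continuous_apply i).comp_continuousOn
        (continuousOn_mulVec_apply (h.continuousOn_inv.mono inter_subset_left) (hyc.sub hyc'))
    · have huU : u ∈ T ∩ Icc s₁ s₀ := ⟨hu.1, hu.2.1.le, hu.2.2⟩
      have h1 := (hasNablaDeriv_inv_mulVec h hs₁ hu (hy u hu
        (hcase.imp_right fun hc hc' => hc (Or.inl hc'))) i).sub huU
        (hasNablaDeriv_inv_mulVec h hs₁ hu (hy' u hu
        (hcase.imp_right fun hc hc' => hc (Or.inr hc'))) i)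
      rw [sub_self] at h1
      simpa only [Matrix.mulVec_sub, Pi.sub_apply] using h1
  have h0 : (X s₀).mulVec (y s₀ - y' s₀) = 0 := by
    refine hL _ fun s hs => ?_
    rw [← hconst s ⟨hs.1, hs.2.1.le, hs.2.2⟩, Matrix.mulVec_mulVec, outputFactor, Matrix.mul_assoc,
      h.mul_inv hs.1, Matrix.mul_one, Matrix.mulVec_sub, hout s hs, sub_self]
  have h1 := congrArg (Φ s₀).mulVec h0
  rw [Matrix.mulVec_mulVec, h.mul_inv hs₀, Matrix.one_mulVec, Matrix.mulVec_zero] at h1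
  exact sub_eq_zero.1 h1

end BackwardSystem

theorem LdCont.piecewiseLdContinuous {f : ℝ → ℝ} (hf : LdCont T f) (hs₁ : s₁ ∈ T) :
    PiecewiseLdContinuous (T ∩ Icc s₁ s₀) f := by
  refine ⟨⟨{s₁}, finite_singleton s₁, fun s hs hsE hr => ?_⟩, fun s hs => ⟨?_, ?_⟩⟩
  · have hlt : s₁ < s := lt_of_le_of_ne hs.2.1 fun h => hsE h.symm
    rw [rho_inter_Icc hs₁ hlt hs.2.2] at hr
    exact ((hf s hs.1).1 hr).mono inter_subset_left
  · rcases (rho_le (T := T) (s := s)).eq_or_lt with hr | hr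
    · exact ⟨f s, ((hf s hs.1).1 hr).tendsto.mono_left
        (nhdsWithin_mono s (inter_subset_left.trans inter_subset_left))⟩
    · refine ⟨0, Tendsto.mono_left (x := 𝓝[T ∩ Iio s] s) ?_
        (nhdsWithin_mono s (inter_subset_inter_left _ inter_subset_left))⟩
      rw [nhdsWithin_Iio_eq_bot hr]
      exact tendsto_bot
  · obtain ⟨l, hl⟩ := (hf s hs.1).2
    exact ⟨l, hl.mono_left (nhdsWithin_mono s (inter_subset_inter_left _ inter_subset_left))⟩

/-- The Gramian of an ld-continuous matrix function `R`, as a nabla antiderivative `Q` of `R Rᵀ`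
that vanishes at `s₀`. If only `w = 0` satisfies `Rᵀ w = 0` on `(s₁, s₀] ∩ T`, then `Q(s₁)` is
nonsingular, since `wᵀ Q w` is an antiderivative of `|Rᵀ w|²`. -/
theorem exists_gramian (hT : IsClosed T) {R : ℝ → Matrix (Fin n) (Fin m) ℝ} (hR : LdCont T R)
    (hs₀ : s₀ ∈ T) (hs₁ : s₁ ∈ T)
    (hinj : ∀ w, (∀ z ∈ T ∩ Ioc s₁ s₀, (R z).transpose.mulVec w = 0) → w = 0) :
    ∃ Q : ℝ → Matrix (Fin n) (Fin n) ℝ, Q s₀ = 0 ∧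
      (∀ s ∈ T, ∀ i j, HasNablaDeriv T (fun t => Q t i j) ((R s * (R s).transpose) i j) s) ∧
      Function.Surjective (Q s₁).mulVec := by
  have hRR : LdCont T fun s => R s * (R s).transpose :=
    hR.matrix_mul (hR.comp_continuous continuous_id.matrix_transpose)
  set Q : ℝ → Matrix (Fin n) (Fin n) ℝ := fun s => Matrix.of fun i j =>
    ∫ t in s₀..s, (R (ceilT T t) * (R (ceilT T t)).transpose) i j with hQ
  have hQd : ∀ s ∈ T, ∀ i j,
      HasNablaDeriv T (fun t => Q t i j) ((R s * (R s).transpose) i j) s :=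
    fun s hs i j => (hRR.entry i j).hasNablaDeriv_integral hT s₀ hs
  have hQ0 : Q s₀ = 0 := by
    ext i j
    simp [hQ]
  refine ⟨Q, hQ0, hQd, ?_⟩
  have hinj' : Function.Injective (Q s₁).mulVecLin := by
    refine (injective_iff_map_eq_zero _).2 fun w hw => ?_
    rw [Matrix.mulVecLin_apply] at hw
    set g : ℝ → ℝ := fun s => (R s).transpose.mulVec w ⬝ᵥ (R s).transpose.mulVec w with hg
    have hgld : LdCont T g := hR.comp_continuous (φ := fun M : Matrix (Fin n) (Fin m) ℝ =>
      M.transpose.mulVec w ⬝ᵥ M.transpose.mulVec w) (by fun_prop)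
    have hg0 : ∀ s, 0 ≤ g s := fun s => Finset.sum_nonneg fun i _ => mul_self_nonneg _
    have hqd : ∀ s ∈ T, HasNablaDeriv T (fun t => w ⬝ᵥ (Q t).mulVec w) (g s) s := by
      intro s hs
      have h1 := HasNablaDeriv.const_dotProduct hs w
        (HasNablaDeriv.mulVec (y := fun _ => w) (e := 0) hs (hQd s hs)
          (fun i => hasNablaDeriv_const (w i)))
      rwa [Matrix.mulVec_zero, add_zero, ← Matrix.mulVec_mulVec, Matrix.dotProduct_mulVec,
        ← Matrix.mulVec_transpose] at h1
    have hint := hgld.intervalIntegrable_comp_ceilT hT ⟨s₀, hs₀⟩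
    have hq : ∀ s ∈ T, w ⬝ᵥ (Q s).mulVec w = ∫ t in s₀..s, g (ceilT T t) := by
      intro s hs
      have h1 := eq_of_hasNablaDeriv_zero_kappa hT (fun u hu => by
        have := (hqd u hu.1).sub hu.1 (hgld.hasNablaDeriv_integral hT s₀ hu.1)
        rwa [sub_self] at this) hs hs₀
      simp only [hQ0, Matrix.zero_mulVec, dotProduct_zero, intervalIntegral.integral_same,
        sub_zero] at h1
      linarith
    have hzero : ∀ s ∈ T ∩ Icc s₁ s₀, w ⬝ᵥ (Q s).mulVec w = 0 := by
      intro s hs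
      have h1 := hq s₁ hs₁
      rw [hw, dotProduct_zero,
        ← intervalIntegral.integral_add_adjacent_intervals (hint s₀ s) (hint s s₁),
        intervalIntegral.integral_symm s₁ s] at h1
      have h2 : 0 ≤ ∫ t in s₁..s, g (ceilT T t) :=
        intervalIntegral.integral_nonneg hs.2.1 fun t _ => hg0 _
      have h3 : 0 ≤ ∫ t in s..s₀, g (ceilT T t) :=
        intervalIntegral.integral_nonneg hs.2.2 fun t _ => hg0 _
      rw [intervalIntegral.integral_symm] at h3
      rw [hq s hs.1]
      linarith
    refine hinj w fun z hz => dotProduct_self_eq_zero.1 ?_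
    exact ((hqd z hz.1).inter_Icc hs₁ hz.2.1 hz.2.2).eq_zero_of_const (hT.inter isClosed_Icc)
      ⟨hz.1, hz.2.1.le, hz.2.2⟩ ⟨hs₁, le_rfl, hz.2.1.le.trans hz.2.2⟩ hz.2.1 hzero
  exact LinearMap.injective_iff_surjective.1 hinj'

/-- Steering by the control `v(s) = R(s)ᵀ c`, where `R` is the input factor and `c` is obtained by
inverting the Gramian. -/
theorem BackwardSystem.controllableOn_of_inputFactor {S : BackwardSystem T n m p}
    {Φ X : ℝ → Matrix (Fin n) (Fin n) ℝ} (hT : IsClosed T) (h : IsFundamentalPair T S.A Φ X)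
    (hs₀ : s₀ ∈ T) (hs₁ : s₁ ∈ T)
    (hR : ∀ w, (∀ z ∈ T ∩ Ioc s₁ s₀, (S.inputFactor X z).transpose.mulVec w = 0) → w = 0) :
    S.ControllableOn s₁ s₀ := by
  intro y₀ y₁
  have hRld := S.ldCont_inputFactor hT h.continuousOn_inv
  obtain ⟨Q, hQ0, hQd, hQs⟩ := exists_gramian hT hRld hs₀ hs₁ hR
  obtain ⟨c, hc⟩ := hQs ((X s₁).mulVec y₁ - (X s₀).mulVec y₀)
  have hQc : ContinuousOn Q T := fun s hs => tendsto_pi_nhds.2 fun i => tendsto_pi_nhds.2 fun j =>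
    (hQd s hs i j).continuousWithinAt hs
  refine ⟨fun s => (S.inputFactor X s).transpose.mulVec c,
    fun t => (Φ t).mulVec ((X s₀).mulVec y₀ + (Q t).mulVec c), fun k => ?_,
    ⟨?_, ∅, finite_empty, fun s hs _ i => ?_⟩, ?_, ?_⟩
  · refine LdCont.piecewiseLdContinuous (hRld.comp_continuous
      (φ := fun M : Matrix (Fin n) (Fin m) ℝ => M.transpose.mulVec c k) (by fun_prop)) hs₁
  · exact (continuousOn_mulVec_apply h.continuousOn (continuousOn_const.add
      (continuousOn_mulVec_apply hQc continuousOn_const))).mono inter_subset_left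
  · have h1 : ∀ i, HasNablaDeriv T (fun t => ((X s₀).mulVec y₀ + (Q t).mulVec c) i)
        ((S.inputFactor X s * (S.inputFactor X s).transpose).mulVec c i) s := by
      intro i
      have h2 := (hasNablaDeriv_const ((X s₀).mulVec y₀ i)).add hs.1
        (HasNablaDeriv.mulVec (y := fun _ => c) (e := 0) hs.1 (hQd s hs.1)
          (fun i => hasNablaDeriv_const (c i)) i)
      rwa [Matrix.mulVec_zero, add_zero, zero_add] at h2
    have h2 := HasNablaDeriv.mulVec hs.1 (h.deriv s (mem_kappa_of_lt hs₁ hs.1 hs.2.1)) h1 i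
    refine HasNablaDeriv.inter_Icc ?_ hs₁ hs.2.1 hs.2.2
    have h3 : S.B s = Φ (rho T s) * S.inputFactor X s := by
      rw [inputFactor, ← Matrix.mul_assoc, h.mul_inv (rho_mem hT hs.1), Matrix.one_mul]
    rw [← Matrix.mulVec_mulVec, ← Matrix.mulVec_mulVec, Matrix.mulVec_mulVec _ (Φ (rho T s)),
      ← h3] at h2
    exact h2
  · simp only [hQ0, Matrix.zero_mulVec, add_zero]
    rw [Matrix.mulVec_mulVec, h.mul_inv hs₀, Matrix.one_mulVec]
  · simp only [hc, add_sub_cancel]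
    rw [Matrix.mulVec_mulVec, h.mul_inv hs₁, Matrix.one_mulVec]

/-! ### The minimality criterion -/

theorem BackwardSystem.isMinimalRealization_iff (hT : IsClosed T) (hT2 : T.Nontrivial)
    {S : BackwardSystem T n m p} (hS : S.Progressive) {G : ℝ → ℝ → Matrix (Fin p) (Fin m) ℝ}
    (hG : S.Realizes G) : S.IsMinimalRealization G ↔
      ∃ s₀ ∈ T, ∃ s₁ ∈ T, s₁ < s₀ ∧ S.ControllableOn s₁ s₀ ∧ S.ObservableOn s₁ s₀ := by
  obtain ⟨Φ, X, h⟩ := hS.exists_isFundamentalPair hT hT2.nonempty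
  constructor
  · rintro ⟨-, hmin⟩
    -- a nonzero vector orthogonal to all columns of the input factor would allow a realization of
    -- smaller dimension; the factorization lemma applies to the transposed input factor
    have hR : ∀ w, (∀ t ∈ T, ∀ s ∈ T, t < s → (S.inputFactor X s).transpose.mulVec w = 0) →
        w = 0 := by
      intro w hw
      by_contra hw0
      obtain ⟨k, hk, P, Q, hPQ⟩ := exists_factor_of_mulVec_eq_zero hw0
      refine hmin k hk (BackwardSystem.exists_realization_of_factor hT hG h Q.transpose P.transpose
        fun s hs z hz => ?_)
      have h1 := ((S.ldCont_inputFactor hT h.continuousOn_inv).comp_continuous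
        continuous_id.matrix_transpose).mulVec_eq_zero hT2 hw hz
      have h2 := congrArg Matrix.transpose (hPQ _ _ h1)
      rw [Matrix.transpose_mul, Matrix.transpose_mul] at h2
      simp only [id, Matrix.transpose_transpose, Matrix.mul_assoc] at h2
      rw [Matrix.mul_assoc, h2]
    have hL : ∀ x, (∀ t ∈ T, ∀ s ∈ T, t < s → (S.outputFactor Φ s).mulVec x = 0) → x = 0 := by
      intro x hx
      by_contra hx0
      obtain ⟨k, hk, P, Q, hPQ⟩ := exists_factor_of_mulVec_eq_zero hx0
      refine hmin k hk (BackwardSystem.exists_realization_of_factor hT hG h P Q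
        fun s hs z hz => ?_)
      have h1 := hPQ _ _ ((S.ldCont_outputFactor h.continuousOn).mulVec_eq_zero hT2 hx hs)
      rw [← Matrix.mul_assoc, Matrix.mul_assoc _ P Q, h1]
    -- both conditions are inherited by larger intervals, so the hull of the two intervals will do
    obtain ⟨a, ha, b, hb, hab, hR'⟩ := exists_Ioc_injective hT2 hR
    obtain ⟨a', ha', b', hb', hab', hL'⟩ := exists_Ioc_injective hT2 hL
    have hmin_mem : min a a' ∈ T := by
      rcases min_choice a a' with h | h <;> simp only [h, ha, ha']
    have hmax_mem : max b b' ∈ T := by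
      rcases max_choice b b' with h | h <;> simp only [h, hb, hb']
    refine ⟨max b b', hmax_mem, min a a', hmin_mem,
      (min_le_left _ _).trans_lt (hab.trans_le (le_max_left _ _)), ?_, ?_⟩
    · refine BackwardSystem.controllableOn_of_inputFactor hT h hmax_mem hmin_mem fun w hw =>
        hR' w fun z hz => hw z ⟨hz.1, ?_, ?_⟩
      · exact (min_le_left _ _).trans_lt hz.2.1
      · exact hz.2.2.trans (le_max_left _ _)
    · refine BackwardSystem.observableOn_of_outputFactor hT h hmax_mem hmin_mem fun x hx =>
        hL' x fun s hs => hx s ⟨hs.1, ?_, ?_⟩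
      · exact (min_le_right _ _).trans_lt hs.2.1
      · exact hs.2.2.trans (le_max_right _ _)
  · rintro ⟨s₀, hs₀, s₁, hs₁, hlt, hc, ho⟩
    refine ⟨hG, fun n' hn' => ?_⟩
    rintro ⟨S', hS', hG'⟩
    obtain ⟨Φ', X', h'⟩ := hS'.exists_isFundamentalPair hT hT2.nonempty
    refine absurd (le_of_factorization (J := T ∩ Ioc s₁ s₀) (L := S.outputFactor Φ)
      (R := S.inputFactor X) (L' := S'.outputFactor Φ') (R' := S'.inputFactor X')
      (fun s hs z hz => ?_) (fun x hx => ho.eq_zero_of_outputFactor h hs₀ hs₁ hx)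
      (fun w hw => hc.eq_zero_of_inputFactor hT h hs₀ hs₁ hlt hw)) (not_le.2 hn')
    have hsk := mem_kappa_of_lt hs₁ hs.1 hs.2.1
    have hzk := mem_kappa_of_lt hs₁ hz.1 hz.2.1
    rw [← BackwardSystem.weightingPattern_eq hT h hs.1 hz.1,
      ← BackwardSystem.weightingPattern_eq hT h' hs.1 hz.1, ← hG s hsk z hzk, hG' s hsk z hzk]

end NablaControl

theorem theorem6p5 (T : Set ℝ) (hT : IsClosed T) (hT2 : T.Nontrivial) (n m p : ℕ)
    (S : NablaControl.BackwardSystem T n m p) (hS : S.Progressive)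
    (G : ℝ → ℝ → Matrix (Fin p) (Fin m) ℝ) (hG : S.Realizes G) :
    S.IsMinimalRealization G ↔
      ∃ s₀ ∈ T, ∃ s₁ ∈ T, s₁ < s₀ ∧ S.ControllableOn s₁ s₀ ∧ S.ObservableOn s₁ s₀ :=
  NablaControl.BackwardSystem.isMinimalRealization_iff hT hT2 hS hG
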